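/- **Farey path.** Identify $\partial_\infty\mathbb H^2$ with $\mathbb P^1\mathbb R$ so that $0,1,\infty$ lie counterclockwise in that order, and join $\frac yx,\frac{y'}{x'}\in\mathbb P^1\mathbb Q$ (reduced fractions) by a line whenever $|xy'-x'y|=1$; this is the Farey triangulation. Let $pqr$ be a Farey triangle and $m\in\mathbb P^1\mathbb Q\smallsetminus\{p,q,r\}$ such that the edge $pq$ separates $r$ from $m$ and $pqm$ is not a Farey triangle. Let $T_0=pqr,T_1,\dots,T_N$ ($N\ge 2$) be the successive Farey triangles crossed by the geodesic $\ell$ from $r$ to $m$ (so $m$ is a vertex of $T_N$). For $1\le i\le N-1$, the edges $T_{i-1}\cap T_i$ and $T_i\cap T_{i+1}$ share exactly one end; $T_i$ *carries an $L$* (resp. *an $R$*) if this is their left (resp. right) end with respect to $\ell$, oriented from $r$ to $m$. **Solid torus.** Let $\alpha\in\mathbb C$, $|\alpha|>1$, and let $\varphi$ be the loxodromy $z\mapsto\alpha z$ of $\mathbb H^3$ (unit ball), where $\mathbb P^1\mathbb C\simeq\mathbb S^2$ by stereographic projection, $\infty$ and $0$ being the North and South poles and $\arg z$ the longitude. Let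 $v$ be the point of the Equator at longitude $0$ (i.e. $z=1$), let $U\subset\mathbb H^3$ be the convex hull of $\{\varphi^n(v)\}_{n\in\mathbb Z}$, and let $X=U/\varphi$. Suppose that $X$ is a hyperbolic punctured solid torus of meridinal slope $m$ with $pqr$-triangulated boundary: there is a homeomorphism $f$ from the punctured torus $\mathbb T=(\mathbb R^2\smallsetminus\mathbb Z^2)/\mathbb Z^2$ to $\partial X=\partial U/\varphi$, orientation-preserving when $\partial X$ is oriented so that its orientation followed by the outward normal is positive, such that the closed curves of slope $m$ lift to closed curves in $\partial U$, and such that $f$ sends the three lines of slopes $p,q,r$ of $\mathbb T$ to ideal geodesic edges that cut $\partial X$ into two totally geodesic ideal triangles. The exterior dihedral angle of $X$ at the edge of slope $r$ is nonzero (those at the edges of slopes $p,q$ may vanish). Here the line of slope $\frac yx$ is the projection to $\mathbb T$ of the straight segment from $(0,0)$ to $(x,y)$ ($x,y$ coprime). **Invariants.** The intersection $J$ of $\partial U$ with the equatorial plane is a broken line from $v$ to $v$, which we orient by increasing longitudes. Let $F$ be the ideal triangle of $\partial U$ with vertex $v$ that contains the initial segment of $J$. For a slope $x$ that is a vertex of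 some $T_i$, $i\ge1$, let $g_x\subset\partial X$ be the image under $f$ of the line of slope $x$, and let $\widehat{g_x}\subset\partial U$ be its lift that starts at $v$ with initial segment contained in $F$, oriented from $v$ to its other end. Let $\nu_x\in\mathbb Z$ be such that $\widehat{g_x}$ runs from $v$ to $\varphi^{\nu_x}(v)$, and let $\lambda_x\in\mathbb R$ be the integral of the longitude $1$-form of $\mathbb S^2\smallsetminus\{\text{poles}\}$ along the closure of the central projection of $\widehat{g_x}$ to $\mathbb S^2$. A loxodromy is *left-handed* (resp. *right-handed*) if it is conjugate to $z\mapsto\beta z$ with $|\beta|>1$ and $\operatorname{Im}\beta>0$ (resp. $\operatorname{Im}\beta<0$). **Proposition.** Let $1\le i\le N-1$ and let $x$ be the Farey vertex common to $T_{i-1},T_i,T_{i+1}$. Then $\widehat{g_x}$, $\nu_x$ and $\lambda_x$ exist, and 1. $\lambda_x\in(0,\pi)$; 2. if $T_i$ carries an $L$ (resp. an $R$), then $\nu_x>0$ (resp. $\nu_x<0$); 3. if $T_i$ carries an $L$ (resp. an $R$), then $\varphi^{\nu_x}$ is left-handed (resp. right-handed). -/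

import Mathlib

open Set Matrix

namespace FareyTorus

/-! ### Slopes and the Farey graph -/

/-- The set of slopes, the rational projective line. -/
abbrev Slope : Type := OnePoint ℚ

instance : DecidableEq Slope := inferInstanceAs (DecidableEq (Option ℚ))

/-- A primitive integer vector `(x, y)` of the given slope `y / x` (it is unique up to sign). -/
def vec (u : Slope) : ℤ × ℤ :=
  u.elim (0, 1) (fun s : ℚ => ((s.den : ℤ), s.num))

/-- The determinant of two integer vectors. -/
def det2 (a b : ℤ × ℤ) : ℤ := a.1 * b.2 - a.2 * b.1

/-- The wedge of two slopes. -/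
def wedge (u w : Slope) : ℕ := (det2 (vec u) (vec w)).natAbs

/-- Ideal triangles of the Farey triangulation, given by their three vertices. -/
def IsFareyTriangle (T : Finset Slope) : Prop :=
  T.card = 3 ∧ ∀ a ∈ T, ∀ b ∈ T, a ≠ b → wedge a b = 1

/-- `a, b, c` are distinct and lie counterclockwise in that order on the circle of slopes, for the
orientation of the circle in which `0, 1, ∞` lie counterclockwise in that order.
(The product does not depend on the signs of the chosen primitive vectors.) -/
def CCW (a b c : Slope) : Prop :=
  det2 (vec a) (vec b) * det2 (vec b) (vec c) * det2 (vec c) (vec a) < 0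

/-- The line of the hyperbolic plane from `a` to `b` separates `c` from `d`. -/
def Separates (a b c d : Slope) : Prop :=
  (CCW a c b ∧ CCW b d a) ∨ (CCW a d b ∧ CCW b c a)

/-- `T 0, T 1, …, T N` are the Farey triangles met, in that order, by a path from the ideal vertex
`r` of `T 0 = pqr` to the ideal vertex `m` of `T N`. The path is transverse to the Farey edges, it
crosses only Farey edges that separate `r` from `m` (like the geodesic from `r` to `m`), and it
crosses each Farey triangle at most once. The condition `2 ≤ N` says that `m` is neither a vertex
of `pqr` nor of the Farey triangle adjacent to `pqr` along `pq`. -/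
structure IsFareyPath (p q r m : Slope) (N : ℕ) (T : ℕ → Finset Slope) : Prop where
  two_le : 2 ≤ N
  triangle : ∀ i ≤ N, IsFareyTriangle (T i)
  start : T 0 = {p, q, r}
  finish : m ∈ T N
  adjacent : ∀ i < N, (T i ∩ T (i + 1)).card = 2
  crosses : ∀ i < N, ∀ a b : Slope, T i ∩ T (i + 1) = {a, b} → Separates a b r m
  once : ∀ i ≤ N, ∀ j ≤ N, T i = T j → i = j

/-- `a` is the left end of a Farey edge crossed by the path oriented from `r` to `m`. -/
def IsLeftEnd (r m a : Slope) : Prop := CCW m a r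

/-- `a` is the right end of a Farey edge crossed by the path oriented from `r` to `m`. -/
def IsRightEnd (r m a : Slope) : Prop := CCW r a m

/-- `T i` carries an `L`: the Farey edges through which the path enters and leaves `T i` share
their left end. -/
def CarriesL (r m : Slope) (T : ℕ → Finset Slope) (i : ℕ) : Prop :=
  ∃ a, a ∈ T (i - 1) ∩ T i ∧ a ∈ T i ∩ T (i + 1) ∧ IsLeftEnd r m a

/-- `T i` carries an `R`: the Farey edges through which the path enters and leaves `T i` share
their right end. -/
def CarriesR (r m : Slope) (T : ℕ → Finset Slope) (i : ℕ) : Prop :=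
  ∃ a, a ∈ T (i - 1) ∩ T i ∧ a ∈ T i ∩ T (i + 1) ∧ IsRightEnd r m a

/-! ### Hyperbolic space

Hyperbolic space is the open unit ball with the projective (Klein) model, in which hyperbolic
convex hulls are Euclidean convex hulls. It has the same central projection to the unit sphere as
the Poincaré ball. A complex number `z` is identified with the point of the sphere of longitude
`arg z` that corresponds to it under stereographic projection from the north pole. -/

abbrev E3 : Type := EuclideanSpace ℝ (Fin 3)

/-- The Hermitian matrix of trace `2` of a point of the closed unit ball: it is positive definite in
the open ball; for the point `z` of the sphere it is proportional to `u uᴴ` with `u = (z, 1)`. -/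
noncomputable def herm (y : E3) : Matrix (Fin 2) (Fin 2) ℂ :=
  !![1 + (y 2 : ℂ), (y 0 : ℂ) + (y 1 : ℂ) * Complex.I;
     (y 0 : ℂ) - (y 1 : ℂ) * Complex.I, 1 - (y 2 : ℂ)]

/-- The action of a Möbius transformation on the closed unit ball: `H ↦ g H gᴴ`, rescaled to have
trace `2`. On the sphere this is the usual action on the complex projective line. -/
noncomputable def mobius (g : GL (Fin 2) ℂ) (y : E3) : E3 :=
  let H : Matrix (Fin 2) (Fin 2) ℂ :=
    (g : Matrix (Fin 2) (Fin 2) ℂ) * herm y * (g : Matrix (Fin 2) (Fin 2) ℂ)ᴴ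
  !₂[2 * (H 0 1).re / H.trace.re, 2 * (H 0 1).im / H.trace.re, (H 0 0 - H 1 1).re / H.trace.re]

/-- The Möbius transformation `z ↦ α z`. For `1 < ‖α‖` it is a loxodromy, with attractive fixed
point the north pole and repulsive fixed point the south pole. -/
noncomputable def phi (α : ℂˣ) : GL (Fin 2) ℂ :=
  Matrix.GeneralLinearGroup.mkOfDetNeZero !![(α : ℂ), 0; 0, 1] (by simp)

/-- `g` is conjugate, as a Möbius transformation, to `z ↦ β z`. -/
def IsConjMul (g : GL (Fin 2) ℂ) (β : ℂ) : Prop :=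
  ∃ (h : GL (Fin 2) ℂ) (c : ℂ),
    ((h * g * h⁻¹ : GL (Fin 2) ℂ) : Matrix (Fin 2) (Fin 2) ℂ) = c • !![β, 0; 0, 1]

/-- Left-handed loxodromies. -/
def IsLeftHanded (g : GL (Fin 2) ℂ) : Prop :=
  ∃ β : ℂ, 1 < ‖β‖ ∧ 0 < β.im ∧ IsConjMul g β

/-- Right-handed loxodromies. -/
def IsRightHanded (g : GL (Fin 2) ℂ) : Prop :=
  ∃ β : ℂ, 1 < ‖β‖ ∧ β.im < 0 ∧ IsConjMul g β

/-! ### The universal cover of the solid torus -/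

/-- The ideal point `v`, on the equator, at longitude `0`. -/
noncomputable def basePt : E3 := !₂[1, 0, 0]

/-- The ideal point `φ ^ n (v)`. -/
noncomputable def orbitPt (α : ℂˣ) (n : ℤ) : E3 := mobius (phi α ^ n) basePt

/-- The convex hull `U` in hyperbolic space of the orbit of `v` under `φ`. -/
noncomputable def hull (α : ℂˣ) : Set E3 :=
  convexHull ℝ (range (orbitPt α)) ∩ Metric.ball 0 1

/-- The boundary of `U` in hyperbolic space. -/
noncomputable def bdry (α : ℂˣ) : Set E3 :=
  frontier (hull α) ∩ Metric.ball 0 1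

/-! ### Solid tori with triangulated boundary -/

/-- An integer vector as a point of the plane. -/
def toPlane (e : ℤ × ℤ) : ℝ × ℝ := ((e.1 : ℝ), (e.2 : ℝ))

/-- `e` is a primitive integer vector whose slope is one of `p, q, r`. -/
def IsEdgeVec (p q r : Slope) (e : ℤ × ℤ) : Prop :=
  ∃ u : Slope, (u = p ∨ u = q ∨ u = r) ∧ (e = vec u ∨ e = -vec u)

/-- `a, b, c` are the vertices of a triangle of the triangulation of the plane that has as its
vertices the integer points, and as its edges the segments of slopes `p, q, r` between integer
points that differ by a primitive vector. -/
def IsPlaneTriangle (p q r : Slope) (a b c : ℤ × ℤ) : Prop :=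
  IsEdgeVec p q r (b - a) ∧ IsEdgeVec p q r (c - b) ∧ IsEdgeVec p q r (a - c)

/-- The determinant of three vectors of space. -/
noncomputable def det3 (a b c : E3) : ℝ :=
  (Matrix.of fun i j : Fin 3 => (![a, b, c] i) j).det

/-- Let `U = hull α` and `X = U / φ`. The structure is the data that make `X` a hyperbolic punctured
solid torus of meridinal slope `m` whose boundary has the `pqr`-triangulation: an identification of
the punctured torus `(ℝ² ∖ ℤ²) / ℤ²` with `∂X = ∂U / φ`.

It is given by its lift `Ψ : ℝ² ∖ ℤ² → ∂U` to the abelian cover of the punctured torus, extended by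
continuity to the punctures (which are sent to the ideal vertices of `U`), and by the homomorphism
`deck : ℤ² → ℤ` that describes the covering `∂U → ∂X`. -/
structure Marking (α : ℂˣ) (p q r m : Slope) where
  /-- The lifted identification. -/
  Ψ : ℝ × ℝ → E3
  /-- The translation by `e` of the plane corresponds to `φ ^ deck e`. -/
  deck : ℤ × ℤ →+ ℤ
  continuous_Ψ : Continuous Ψ
  map_zero : Ψ 0 = basePt
  mapsTo : ∀ x, x ∉ range toPlane → Ψ x ∈ bdry α
  /-- `∂U` is a topological quotient of `ℝ² ∖ ℤ²`. -/
  isQuotientMap : Topology.IsQuotientMap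
    (fun x : {x : ℝ × ℝ // x ∉ range toPlane} => (⟨Ψ x, mapsTo x x.2⟩ : bdry α))
  /-- Equivariance, and injectivity of the induced map from `(ℝ² ∖ ℤ²) / ℤ²` to `∂U / φ`. -/
  map_eq_iff : ∀ (x y : ℝ × ℝ) (n : ℤ),
    mobius (phi α ^ n) (Ψ x) = Ψ y ↔ ∃ e : ℤ × ℤ, deck e = n ∧ y = x + toPlane e
  /-- The closed curves of slope `m` in `∂X` lift to closed curves in `∂U`, that is, they are
  homotopically trivial in `X`. -/
  meridian : deck (vec m) = 0
  /-- The lines of slopes `p, q, r` in `∂X` are ideal geodesic edges. -/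
  edge : ∀ a b : ℤ × ℤ, IsEdgeVec p q r (b - a) →
    Ψ '' segment ℝ (toPlane a) (toPlane b) = segment ℝ (Ψ (toPlane a)) (Ψ (toPlane b))
  /-- The complementary regions of these lines in `∂X` are totally geodesic ideal triangles. -/
  face : ∀ a b c : ℤ × ℤ, IsPlaneTriangle p q r a b c →
    Ψ '' convexHull ℝ {toPlane a, toPlane b, toPlane c} =
      convexHull ℝ {Ψ (toPlane a), Ψ (toPlane b), Ψ (toPlane c)}
  /-- The identification followed by the outward normal is positively oriented: a triangle that is
  counterclockwise in the plane is counterclockwise in `∂U` as seen from outside of `U`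
  (the centre of the ball is inside `U`). -/
  orientation : ∀ a b c : ℤ × ℤ, IsPlaneTriangle p q r a b c → 0 < det2 (b - a) (c - a) →
    0 < det3 (Ψ (toPlane a)) (Ψ (toPlane b)) (Ψ (toPlane c))
  /-- The exterior dihedral angle of `X` along the edge of slope `r` is not zero: the two ideal
  triangles adjacent to such an edge are not coplanar. -/
  bent : ∀ a b c d : ℤ × ℤ, IsPlaneTriangle p q r a b c → IsPlaneTriangle p q r a b d → c ≠ d →
    (b - a = vec r ∨ b - a = -vec r) →
    AffineIndependent ℝ ![Ψ (toPlane a), Ψ (toPlane b), Ψ (toPlane c), Ψ (toPlane d)]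

namespace Marking

variable {α : ℂˣ} {p q r m : Slope}

/-- The ideal triangle of `∂U` with vertices `v = Ψ 0`, `Ψ a`, `Ψ b`. -/
noncomputable def triangleAt (M : Marking α p q r m) (a b : ℤ × ℤ) : Set E3 :=
  convexHull ℝ {M.Ψ 0, M.Ψ (toPlane a), M.Ψ (toPlane b)}

/-- The ideal triangle of `∂U` with vertices `v, Ψ a, Ψ b` is the one that contains the initial
segment, from `v`, of the intersection `J` of `∂U` with the equatorial plane, oriented along
increasing longitudes. (There is one point of `J` on each ray from the centre of the ball to a point
of the equator outside of the orbit of `v`, so `J` is parametrized by the longitude.) -/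
def IsFirstTriangle (M : Marking α p q r m) (a b : ℤ × ℤ) : Prop :=
  IsPlaneTriangle p q r 0 a b ∧
    ∃ ε > 0, ∀ t ∈ Ioo (0 : ℝ) ε, ∃ ρ > 0, !₂[ρ * Real.cos t, ρ * Real.sin t, 0] ∈ M.triangleAt a b

/-- The curve `t ↦ Ψ (t w)`, `0 ≤ t ≤ 1`, is a lift to `∂U`, with its two ideal endpoints, of the
line of slope `x` in `∂X`. It starts at `v`, and its initial segment is in the ideal triangle of
`∂U` at `v` that contains the initial segment of `J`. -/
def IsOrientedLift (M : Marking α p q r m) (x : Slope) (w : ℤ × ℤ) : Prop :=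
  (w = vec x ∨ w = -vec x) ∧
    ∃ a b : ℤ × ℤ, M.IsFirstTriangle a b ∧
      ∃ ε > 0, ∀ t ∈ Ioo (0 : ℝ) ε, M.Ψ (t • toPlane w) ∈ M.triangleAt a b

end Marking

/-- The central projection to the unit sphere. -/
noncomputable def centralProj (y : E3) : E3 := ‖y‖⁻¹ • y

/-- The integral of the longitude `1`-form along the continuous curve `c : [0, 1] → E3`, which
avoids the axis through the poles, is `l`: it is the variation of a continuous choice of the
longitude. -/
def HasLongitudeIntegral (c : ℝ → E3) (l : ℝ) : Prop :=
  ∃ θ : ℝ → ℝ, ContinuousOn θ (Icc 0 1) ∧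
    (∀ t ∈ Icc (0 : ℝ) 1, ∃ ρ > 0, c t 0 = ρ * Real.cos (θ t) ∧ c t 1 = ρ * Real.sin (θ t)) ∧
    l = θ 1 - θ 0

/-- `ν` and `l` are the exponent and the longitude integral of the slope `x`: the oriented lift of
the line of slope `x` runs from `v` to `φ ^ ν (v)`, and the integral of the longitude `1`-form along
its central projection is `l`. -/
def Marking.HasInvariants {α : ℂˣ} {p q r m : Slope} (M : Marking α p q r m) (x : Slope)
    (ν : ℤ) (l : ℝ) : Prop :=
  ∃ w : ℤ × ℤ, M.IsOrientedLift x w ∧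
    M.Ψ (toPlane w) = mobius (phi α ^ ν) basePt ∧
    HasLongitudeIntegral (fun t => centralProj (M.Ψ (t • toPlane w))) l

end FareyTorus

/-!
The homomorphism `deck : ℤ² → ℤ` of the marking vanishes on the meridian vector `E`, hence it is a
multiple of `det2 E`. The longitude of points of `∂U`, lifted to the abelian cover `ℝ²` of the
punctured torus, gives a second homomorphism `Θ : ℤ² → ℝ`, and `λ_x = Θ w`, `ν_x = deck w` for the
vector `±w` of slope `x` that points into the first triangle (`IsLongitude.hasInvariants_iff`). As
`Θ w` is an argument of `α ^ deck w`, handedness follows from `0 < Θ w < π` and the sign of `deck w`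
(`isLeftHanded_or_of_im_pos`).

Choose vectors `P, Q` of `p, q` such that `P - Q` has slope `r` and `E = k P + l Q` with `k, l > 0`.
Along a Farey path a pivot has a vector `w` in the cone of `P, Q`, and `E = A w + B (w + y)` with
`A, B ≥ 1` and `y` in the cone (`IsFareyPath.exists_pivot`). Up to a change of all signs, `Θ` is
positive on the cone and `(A + B) Θ w + B Θ y = Θ E = 2π`, which gives `0 < Θ w < π`. This uses two
facts:

* `Θ P` and `Θ Q` have the same sign (`IsLongitude.same_sign`). Both are less than `π` in absolute
  value, because an edge is a chord that misses the axis. The signs are those of the imaginary parts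
  of `α ^ deck P` and `α ^ deck Q`. Seen from `v`, moved to infinity, the faces around `v` are the
  sides of a convex hexagon. The supporting plane of the face with vertices `v, P, Q` leaves both
  poles on the inner side, and the hexagon is strictly convex at the vertex of the edge of slope
  `r`; an inequality of real numbers (`im_mul_im_neg_of_convex`) then puts the vertices of `P` and
  `-Q` on different sides of the plane of `v` and the axis, hence those of `P` and `Q` on the same
  side.
* `Θ E = ± 2π`: the meridian winds once around the axis (`IsLongitude.meridian_eq`). If
  `Θ E = 2kπ`, then `exp (i θ / k)` descends to a continuous `k`-th root of the longitude on `∂U`,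
  because `∂U` is a quotient of the abelian cover by the meridian, and there is no such root on a
  loop around the axis unless `k = 1`.

When `Θ P, Θ Q > 0`, the first triangle at `v` is the one with vertices `v, P, Q`, because it must
have vertices of both signs of height, and the orientation of `∂U` makes `deck` a positive multiple
of `det2 E`; the sign of `det2 E w` says whether the pivot is on the left or on the right.
-/

namespace FareyTorus

open scoped Topology

/-! ### Farey paths in terms of integer vectors -/

/-- `e` is one of the two primitive integer vectors of slope `u`. -/
def IsRep (e : ℤ × ℤ) (u : Slope) : Prop := e = vec u ∨ e = -vec u

lemma IsRep.neg {e : ℤ × ℤ} {u : Slope} (h : IsRep e u) : IsRep (-e) u := by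
  rcases h with rfl | rfl
  · exact Or.inr rfl
  · exact Or.inl (neg_neg _)

lemma isRep_vec (u : Slope) : IsRep (vec u) u := Or.inl rfl

lemma det2_self (a : ℤ × ℤ) : det2 a a = 0 := by simp only [det2]; ring
lemma det2_neg_left (a b : ℤ × ℤ) : det2 (-a) b = -det2 a b := by
  simp only [det2, Prod.fst_neg, Prod.snd_neg]; ring
lemma det2_neg_right (a b : ℤ × ℤ) : det2 a (-b) = -det2 a b := by
  simp only [det2, Prod.fst_neg, Prod.snd_neg]; ring
lemma det2_comm (a b : ℤ × ℤ) : det2 a b = -det2 b a := by simp only [det2]; ring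
lemma det2_add_left (a b c : ℤ × ℤ) : det2 (a + b) c = det2 a c + det2 b c := by
  simp only [det2, Prod.fst_add, Prod.snd_add]; ring
lemma det2_add_right (a b c : ℤ × ℤ) : det2 a (b + c) = det2 a b + det2 a c := by
  simp only [det2, Prod.fst_add, Prod.snd_add]; ring
lemma det2_sub_left (a b c : ℤ × ℤ) : det2 (a - b) c = det2 a c - det2 b c := by
  simp only [det2, Prod.fst_sub, Prod.snd_sub]; ring
lemma det2_sub_right (a b c : ℤ × ℤ) : det2 a (b - c) = det2 a b - det2 a c := by
  simp only [det2, Prod.fst_sub, Prod.snd_sub]; ring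
lemma det2_smul_left (k : ℤ) (a b : ℤ × ℤ) : det2 (k • a) b = k * det2 a b := by
  simp only [det2, Prod.smul_fst, Prod.smul_snd, smul_eq_mul]; ring
lemma det2_smul_right (k : ℤ) (a b : ℤ × ℤ) : det2 a (k • b) = k * det2 a b := by
  simp only [det2, Prod.smul_fst, Prod.smul_snd, smul_eq_mul]; ring

lemma isCoprime_vec (u : Slope) : IsCoprime (vec u).1 (vec u).2 := by
  induction u using OnePoint.rec with
  | infty => exact ⟨0, 1, by simp [vec]⟩
  | coe s =>
    have := s.reduced
    have h : IsCoprime (s.num) (s.den : ℤ) := by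
      rw [Int.isCoprime_iff_gcd_eq_one]
      simpa [Int.gcd, Nat.Coprime] using this
    exact h.symm

lemma isCoprime_of_isRep {e : ℤ × ℤ} {u : Slope} (h : IsRep e u) : IsCoprime e.1 e.2 := by
  rcases h with rfl | rfl
  · exact isCoprime_vec u
  · exact (isCoprime_vec u).neg_neg

lemma slope_eq_of_vec_eq {u w : Slope} (h : vec u = vec w) : u = w := by
  induction u using OnePoint.rec with
  | infty =>
    induction w using OnePoint.rec with
    | infty => rfl
    | coe s => simp [vec] at h; exact absurd h.1.symm (by exact_mod_cast s.den_nz)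
  | coe s =>
    induction w using OnePoint.rec with
    | infty => simp [vec] at h
    | coe t =>
      simp [vec] at h
      rw [Rat.ext h.2 h.1]

lemma vec_ne_neg_vec (u w : Slope) : vec u ≠ -vec w := by
  intro h
  induction u using OnePoint.rec with
  | infty =>
    induction w using OnePoint.rec with
    | infty => simp [vec] at h
    | coe s => simp [vec, Prod.ext_iff] at h
  | coe s =>
    induction w using OnePoint.rec with
    | infty => simp [vec, Prod.ext_iff] at h
    | coe t =>
      simp only [vec, OnePoint.elim_some, Prod.ext_iff, Prod.fst_neg] at h
      have h1 := s.den_pos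
      have h2 := t.den_pos
      omega

/-- A vector represents at most one slope. -/
lemma IsRep.unique {e : ℤ × ℤ} {u w : Slope} (hu : IsRep e u) (hw : IsRep e w) : u = w := by
  rcases hu with rfl | rfl <;> rcases hw with h | h
  · exact slope_eq_of_vec_eq h
  · exact absurd h (vec_ne_neg_vec _ _)
  · exact absurd h.symm (vec_ne_neg_vec _ _)
  · exact slope_eq_of_vec_eq (neg_injective h)

lemma IsRep.eq_or_eq_neg {e f : ℤ × ℤ} {u : Slope} (he : IsRep e u) (hf : IsRep f u) :
    f = e ∨ f = -e := by
  rcases he with rfl | rfl <;> rcases hf with rfl | rfl <;> simp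

lemma wedge_eq_one_iff {a b : Slope} {A B : ℤ × ℤ} (hA : IsRep A a) (hB : IsRep B b) :
    wedge a b = 1 ↔ (det2 A B = 1 ∨ det2 A B = -1) := by
  rw [wedge, Int.natAbs_eq_iff]
  rcases hA with rfl | rfl <;> rcases hB with rfl | rfl <;>
    simp only [det2_neg_left, det2_neg_right, Nat.cast_one] <;> omega

lemma ccw_iff {a b c : Slope} {A B C : ℤ × ℤ} (hA : IsRep A a) (hB : IsRep B b)
    (hC : IsRep C c) : CCW a b c ↔ det2 A B * det2 B C * det2 C A < 0 := by
  rw [CCW]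
  rcases hA with rfl | rfl <;> rcases hB with rfl | rfl <;> rcases hC with rfl | rfl <;>
    simp only [det2_neg_left, det2_neg_right, neg_mul, mul_neg, neg_neg]

lemma Separates.neg_of_isRep {a b c d : Slope} (h : Separates a b c d) {A B C D : ℤ × ℤ}
    (hA : IsRep A a) (hB : IsRep B b) (hC : IsRep C c) (hD : IsRep D d) :
    (det2 A C * det2 C B) * (det2 A D * det2 D B) < 0 := by
  have key : ∀ x y z x' y' : ℤ, x * y * z < 0 → x' * y' * (-z) < 0 → (x * y) * (x' * y') < 0 := by
    intro x y z x' y' h1 h2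
    have hz : 0 < z ^ 2 := by
      rcases eq_or_ne z 0 with rfl | hz
      · simp at h1
      · positivity
    have : 0 < (x * y * z) * (x' * y' * (-z)) := mul_pos_of_neg_of_neg h1 h2
    nlinarith
  rcases h with ⟨h1, h2⟩ | ⟨h1, h2⟩
  · rw [ccw_iff hA hC hB] at h1
    rw [ccw_iff hB hD hA, det2_comm B D, det2_comm D A] at h2
    have := key _ _ _ (det2 A D) (det2 D B) h1 (by rw [det2_comm B A]; linarith)
    exact this
  · rw [ccw_iff hA hD hB] at h1
    rw [ccw_iff hB hC hA, det2_comm B C, det2_comm C A] at h2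
    have := key _ _ _ (det2 A C) (det2 C B) h1 (by rw [det2_comm B A]; linarith)
    linarith

/-- Cramer's rule for a unimodular pair of integer vectors. -/
lemma eq_smul_add_smul {A B : ℤ × ℤ} (h : det2 A B = 1 ∨ det2 A B = -1) (e : ℤ × ℤ) :
    e = (det2 A B * det2 e B) • A + (det2 A B * det2 A e) • B := by
  have h2 : det2 A B * det2 A B = 1 := by rcases h with h | h <;> rw [h] <;> rfl
  ext
  · have : e.1 = e.1 * (det2 A B * det2 A B) := by rw [h2, mul_one]
    rw [this]
    simp only [det2, Prod.fst_add, Prod.smul_fst, smul_eq_mul]; ring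
  · have : e.2 = e.2 * (det2 A B * det2 A B) := by rw [h2, mul_one]
    rw [this]
    simp only [det2, Prod.snd_add, Prod.smul_snd, smul_eq_mul]; ring

/-- A Farey triangle with the edge `ab` has its third vertex at one of two slopes. -/
lemma IsFareyTriangle.exists_third {T : Finset Slope} (hT : IsFareyTriangle T) {a b : Slope}
    (ha : a ∈ T) (hb : b ∈ T) (hab : a ≠ b) {A B : ℤ × ℤ} (hA : IsRep A a) (hB : IsRep B b) :
    ∃ c, T = {a, b, c} ∧ c ≠ a ∧ c ≠ b ∧ (IsRep (A + B) c ∨ IsRep (A - B) c) := by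
  obtain ⟨hcard, hw⟩ := hT
  have hsub : ({a, b} : Finset Slope) ⊆ T := by
    intro x hx; simp only [Finset.mem_insert, Finset.mem_singleton] at hx
    rcases hx with rfl | rfl <;> assumption
  have h1 : (T \ {a, b}).card = 1 := by
    rw [Finset.card_sdiff_of_subset hsub, hcard, Finset.card_pair hab]
  obtain ⟨c, hc⟩ := Finset.card_eq_one.1 h1
  have hcT : c ∈ T \ {a, b} := by rw [hc]; simp
  simp only [Finset.mem_sdiff, Finset.mem_insert, Finset.mem_singleton, not_or] at hcT
  obtain ⟨hcT, hca, hcb⟩ := hcT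
  refine ⟨c, ?_, hca, hcb, ?_⟩
  · rw [← Finset.sdiff_union_of_subset hsub, hc]
    ext x; simp only [Finset.mem_union, Finset.mem_insert, Finset.mem_singleton]; tauto
  · have hAB := (wedge_eq_one_iff hA hB).1 (hw a ha b hb hab)
    have hAC := (wedge_eq_one_iff hA (isRep_vec c)).1 (hw a ha c hcT (Ne.symm hca))
    have hCB := (wedge_eq_one_iff (isRep_vec c) hB).1 (hw c hcT b hb hcb)
    have he := eq_smul_add_smul hAB (vec c)
    unfold IsRep
    rcases hAB with h | h <;> rcases hAC with h' | h' <;> rcases hCB with h'' | h'' <;>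
      rw [h, h', h''] at he <;> rw [he] <;> simp [Prod.ext_iff] <;> omega

/-- The edge `ab` through which a Farey path leaves `T i`, with vectors `A, B` of its ends. They lie
in the cone spanned by `P, Q`, and the meridian vector `E` lies strictly between them. -/
structure FareyEdge (P Q E : ℤ × ℤ) (T : ℕ → Finset Slope) (i : ℕ) (A B : ℤ × ℤ)
    (a b : Slope) : Prop where
  repA : IsRep A a
  repB : IsRep B b
  inter : T i ∩ T (i + 1) = {a, b}
  unimod : det2 A B = 1 ∨ det2 A B = -1
  coneA : ∃ x y : ℤ, 0 ≤ x ∧ 0 ≤ y ∧ 0 < x + y ∧ A = x • P + y • Q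
  coneB : ∃ x y : ℤ, 0 ≤ x ∧ 0 ≤ y ∧ 0 < x + y ∧ B = x • P + y • Q
  between : ∃ k l : ℤ, 0 < k ∧ 0 < l ∧ E = k • A + l • B
  next : ∃ c, IsRep (A + B) c ∧ T (i + 1) = {a, b, c} ∧ c ≠ a ∧ c ≠ b

lemma FareyEdge.symm {P Q E : ℤ × ℤ} {T : ℕ → Finset Slope} {i : ℕ} {A B : ℤ × ℤ} {a b : Slope}
    (h : FareyEdge P Q E T i A B a b) : FareyEdge P Q E T i B A b a where
  repA := h.repB
  repB := h.repA
  inter := by rw [h.inter, Finset.pair_comm]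
  unimod := by rw [det2_comm B A]; have := h.unimod; omega
  coneA := h.coneB
  coneB := h.coneA
  between := by
    obtain ⟨k, l, hk, hl, e⟩ := h.between
    exact ⟨l, k, hl, hk, by rw [e, add_comm]⟩
  next := by
    obtain ⟨c, h1, h2, h3, h4⟩ := h.next
    exact ⟨c, by rwa [add_comm], by rw [h2, Finset.insert_comm], h4, h3⟩

lemma FareyEdge.ne {P Q E : ℤ × ℤ} {T : ℕ → Finset Slope} {i : ℕ} {A B : ℤ × ℤ} {a b : Slope}
    (h : FareyEdge P Q E T i A B a b) : a ≠ b := by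
  rintro rfl
  have h1 := h.unimod
  rcases h.repA.eq_or_eq_neg h.repB with e | e <;> rw [e] at h1 <;>
    simp only [det2_neg_right, det2_self] at h1 <;> omega

lemma det2_cone_left {P Q A : ℤ × ℤ} (hPQ : det2 P Q = 1)
    (h : ∃ x y : ℤ, 0 ≤ x ∧ 0 ≤ y ∧ 0 < x + y ∧ A = x • P + y • Q) : det2 A (P - Q) < 0 := by
  obtain ⟨x, y, hx, hy, hxy, rfl⟩ := h
  rw [det2_add_left, det2_smul_left, det2_smul_left, det2_sub_right, det2_sub_right, det2_self,
    det2_self, det2_comm Q P, hPQ]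
  linarith

/-- A Farey path that crosses the edge `ab` towards `m` next crosses one of the two edges from `a`
or `b` to the new vertex. -/
lemma FareyEdge.step_of_mem {p q r m : Slope} {N : ℕ} {T : ℕ → Finset Slope}
    (hT : IsFareyPath p q r m N T) {P Q E : ℤ × ℤ} (hPQ : det2 P Q = 1)
    (hr : IsRep (P - Q) r) (hE : IsRep E m) {i : ℕ} (hi : i + 1 < N) {A B : ℤ × ℤ} {a b c : Slope}
    (h : FareyEdge P Q E T i A B a b) (hc : IsRep (A + B) c) (hca : c ≠ a)
    (hTi : T (i + 1) = {a, b, c}) (hint : T (i + 1) ∩ T (i + 2) = {a, c}) :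
    FareyEdge P Q E T (i + 1) A (A + B) a c := by
  have hcone : ∃ x y : ℤ, 0 ≤ x ∧ 0 ≤ y ∧ 0 < x + y ∧ A + B = x • P + y • Q := by
    obtain ⟨x, y, hx, hy, hxy, e⟩ := h.coneA
    obtain ⟨x', y', hx', hy', hxy', e'⟩ := h.coneB
    refine ⟨x + x', y + y', by omega, by omega, by omega, ?_⟩
    rw [e, e', add_smul, add_smul]; abel
  refine ⟨h.repA, hc, hint, ?_, h.coneA, hcone, ?_, ?_⟩
  · rw [det2_add_right, det2_self, zero_add]; exact h.unimod
  · obtain ⟨k, l, hk, hl, e⟩ := h.between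
    have hs := (hT.crosses (i + 1) hi a c hint).neg_of_isRep h.repA hc hr hE
    have h1 := det2_cone_left hPQ h.coneA
    have h2 := det2_cone_left hPQ hcone
    rw [det2_comm (P - Q) (A + B)] at hs
    have h3 : det2 A E * det2 E (A + B) = l * (k - l) := by
      have : det2 A B * det2 A B = 1 := by rcases h.unimod with h | h <;> rw [h] <;> rfl
      rw [e, det2_add_right, det2_add_left, det2_smul_left, det2_smul_left, det2_add_right,
        det2_add_right, det2_smul_right, det2_smul_right, det2_self, det2_self, det2_comm B A]
      linear_combination l * (k - l) * this
    rw [h3] at hs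
    have h4 : 0 < -(det2 A (P - Q) * -det2 (A + B) (P - Q)) := by
      have := mul_pos_of_neg_of_neg h1 h2
      linarith
    have h5 : 0 < l * (k - l) := by
      by_contra hneg
      push Not at hneg
      nlinarith
    have h6 : 0 < k - l := by
      by_contra hneg
      push Not at hneg
      nlinarith
    refine ⟨k - l, l, h6, hl, ?_⟩
    rw [e, sub_smul, smul_add]; abel
  · have hm : ∀ x, x ∈ ({a, c} : Finset Slope) → x ∈ T (i + 2) := by
      intro x hx
      rw [← hint] at hx
      exact (Finset.mem_inter.1 hx).2
    obtain ⟨d, hd, hda, hdc, hrep⟩ := (hT.triangle (i + 2) (by omega)).exists_third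
      (hm a (by simp)) (hm c (by simp)) (Ne.symm hca) h.repA hc
    refine ⟨d, ?_, hd, hda, hdc⟩
    rcases hrep with h' | h'
    · exact h'
    · exfalso
      have : d = b := by
        apply IsRep.unique h'
        have : A - (A + B) = -B := by abel
        rw [this]; exact h.repB.neg
      have := hT.once (i + 2) (by omega) (i + 1) (by omega) (by
        rw [hd, hTi, this, Finset.pair_comm])
      omega

lemma FareyEdge.step {p q r m : Slope} {N : ℕ} {T : ℕ → Finset Slope}
    (hT : IsFareyPath p q r m N T) {P Q E : ℤ × ℤ} (hPQ : det2 P Q = 1)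
    (hr : IsRep (P - Q) r) (hE : IsRep E m) {i : ℕ} (hi : i + 1 < N) {A B : ℤ × ℤ} {a b : Slope}
    (h : FareyEdge P Q E T i A B a b) :
    ∃ A' B' a' b' c', FareyEdge P Q E T i A' B' a' b' ∧
      FareyEdge P Q E T (i + 1) A' (A' + B') a' c' ∧ b' ≠ c' := by
  obtain ⟨c, hc, hTi, hca, hcb⟩ := h.next
  obtain ⟨d, e, hde, hint⟩ := Finset.card_eq_two.1 (hT.adjacent (i + 1) hi)
  have hd : d ∈ T (i + 1) ∩ T (i + 2) := by rw [hint]; simp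
  have he : e ∈ T (i + 1) ∩ T (i + 2) := by rw [hint]; simp
  obtain ⟨hd1, hd2⟩ := Finset.mem_inter.1 hd
  obtain ⟨he1, he2⟩ := Finset.mem_inter.1 he
  -- The path does not turn back: only two Farey triangles have the edge `ab`.
  have hback : ¬ (a ∈ T (i + 2) ∧ b ∈ T (i + 2)) := by
    rintro ⟨ha, hb⟩
    have hm : ∀ x, x ∈ ({a, b} : Finset Slope) → x ∈ T i := by
      intro x hx
      rw [← h.inter] at hx
      exact (Finset.mem_inter.1 hx).1
    obtain ⟨c₂, e₂, -, -, h₂⟩ := (hT.triangle (i + 2) (by omega)).exists_third ha hb h.ne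
      h.repA h.repB
    obtain ⟨c₀, e₀, -, -, h₀⟩ := (hT.triangle i (by omega)).exists_third (hm a (by simp))
      (hm b (by simp)) h.ne h.repA h.repB
    rcases h₂ with h₂ | h₂
    · have := hT.once (i + 2) (by omega) (i + 1) (by omega) (by rw [e₂, hTi, h₂.unique hc])
      omega
    · rcases h₀ with h₀ | h₀
      · have := hT.once i (by omega) (i + 1) (by omega) (by rw [e₀, hTi, h₀.unique hc])
        omega
      · have := hT.once i (by omega) (i + 2) (by omega) (by rw [e₀, e₂, h₀.unique h₂])
        omega
  have hcases : T (i + 1) ∩ T (i + 2) = {a, c} ∨ T (i + 1) ∩ T (i + 2) = {b, c} := by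
    rw [hTi] at hd1 he1
    simp only [Finset.mem_insert, Finset.mem_singleton] at hd1 he1
    rw [hint]
    rcases hd1 with hd1 | hd1 | hd1 <;> rcases he1 with he1 | he1 | he1
    · exact absurd (hd1.trans he1.symm) hde
    · exact absurd ⟨hd1 ▸ hd2, he1 ▸ he2⟩ hback
    · exact Or.inl (by rw [hd1, he1])
    · exact absurd ⟨he1 ▸ he2, hd1 ▸ hd2⟩ hback
    · exact absurd (hd1.trans he1.symm) hde
    · exact Or.inr (by rw [hd1, he1])
    · exact Or.inl (by rw [hd1, he1, Finset.pair_comm])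
    · exact Or.inr (by rw [hd1, he1, Finset.pair_comm])
    · exact absurd (hd1.trans he1.symm) hde
  rcases hcases with hint | hint
  · exact ⟨A, B, a, b, c, h, h.step_of_mem hT hPQ hr hE hi hc hca hTi hint, Ne.symm hcb⟩
  · refine ⟨B, A, b, a, c, h.symm, ?_, Ne.symm hca⟩
    exact h.symm.step_of_mem hT hPQ hr hE hi (by rwa [add_comm]) hcb
      (by rw [hTi, Finset.insert_comm]) hint

/-- A Farey path starts through the edge `pq`. The vectors `P, Q` of `p` and `q`, in one of the two
orders, are chosen positively oriented, with `P - Q` a vector of `r`. -/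
lemma IsFareyPath.exists_basis {p q r m : Slope} {N : ℕ} {T : ℕ → Finset Slope}
    (hT : IsFareyPath p q r m N T) :
    ∃ P Q E : ℤ × ℤ, ∃ a b : Slope, ((a = p ∧ b = q) ∨ (a = q ∧ b = p)) ∧ det2 P Q = 1 ∧
      IsRep (P - Q) r ∧ IsRep E m ∧ FareyEdge P Q E T 0 P Q a b := by
  have hN := hT.two_le
  have hT0 := hT.triangle 0 (by omega)
  have hcard := hT0.1
  rw [hT.start] at hcard
  have hpq : p ≠ q := by
    rintro rfl
    have : ({p, p, r} : Finset Slope).card ≤ 2 := by simpa using Finset.card_le_two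
    omega
  have hpr : p ≠ r := by
    rintro rfl
    have : ({p, q, p} : Finset Slope).card ≤ 2 := by
      rw [Finset.insert_comm]; simpa using Finset.card_le_two
    omega
  have hqr : q ≠ r := by
    rintro rfl
    have : ({p, q, q} : Finset Slope).card ≤ 2 := by simpa using Finset.card_le_two
    omega
  obtain ⟨d, e, hde, hint⟩ := Finset.card_eq_two.1 (hT.adjacent 0 (by omega))
  have hsep := hT.crosses 0 (by omega) d e hint
  have hdr : d ≠ r := by
    rintro rfl
    have := hsep.neg_of_isRep (isRep_vec d) (isRep_vec e) (isRep_vec d) (isRep_vec m)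
    simp [det2_self] at this
  have her : e ≠ r := by
    rintro rfl
    have := hsep.neg_of_isRep (isRep_vec d) (isRep_vec e) (isRep_vec e) (isRep_vec m)
    simp [det2_self] at this
  have hd : d ∈ T 0 ∩ T 1 := by rw [hint]; simp
  have he : e ∈ T 0 ∩ T 1 := by rw [hint]; simp
  have hint' : T 0 ∩ T 1 = {p, q} := by
    have hd1 := (Finset.mem_inter.1 hd).1
    have he1 := (Finset.mem_inter.1 he).1
    rw [hT.start] at hd1 he1
    simp only [Finset.mem_insert, Finset.mem_singleton] at hd1 he1
    rw [hint]
    rcases hd1 with rfl | rfl | rfl <;> rcases he1 with rfl | rfl | rfl <;>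
      first
      | exact absurd rfl hde
      | exact absurd rfl hdr
      | exact absurd rfl her
      | rfl
      | exact Finset.pair_comm _ _
  -- Signs of the vectors.
  have main : ∃ P Q : ℤ × ℤ, ∃ a b : Slope, ((a = p ∧ b = q) ∨ (a = q ∧ b = p)) ∧ det2 P Q = 1 ∧
      IsRep (P - Q) r ∧ IsRep P a ∧ IsRep Q b := by
    obtain ⟨c, hc, -, -, hrep⟩ := hT0.exists_third (by rw [hT.start]; simp)
      (by rw [hT.start]; simp) hpq (isRep_vec p) (isRep_vec q)
    have hcr : c = r := by
      have : r ∈ ({p, q, c} : Finset Slope) := by rw [← hc, hT.start]; simp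
      simp only [Finset.mem_insert, Finset.mem_singleton] at this
      rcases this with h | h | h
      · exact absurd h.symm hpr
      · exact absurd h.symm hqr
      · exact h.symm
    subst hcr
    have hw := (wedge_eq_one_iff (isRep_vec p) (isRep_vec q)).1
      (hT0.2 p (by rw [hT.start]; simp) q (by rw [hT.start]; simp) hpq)
    have key : ∀ P Q : ℤ × ℤ, IsRep P p → IsRep Q q → (det2 P Q = 1 ∨ det2 P Q = -1) →
        IsRep (P - Q) c → ∃ P Q : ℤ × ℤ, ∃ a b : Slope, ((a = p ∧ b = q) ∨ (a = q ∧ b = p)) ∧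
          det2 P Q = 1 ∧ IsRep (P - Q) c ∧ IsRep P a ∧ IsRep Q b := by
      intro P Q hP hQ hd hc
      rcases hd with hd | hd
      · exact ⟨P, Q, p, q, Or.inl ⟨rfl, rfl⟩, hd, hc, hP, hQ⟩
      · refine ⟨Q, P, q, p, Or.inr ⟨rfl, rfl⟩, by rw [det2_comm, hd]; rfl, ?_, hQ, hP⟩
        rw [← neg_sub]; exact hc.neg
    rcases hrep with h | h
    · refine key (vec p) (-vec q) (isRep_vec p) (isRep_vec q).neg ?_ (by rwa [sub_neg_eq_add])
      rw [det2_neg_right]; omega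
    · exact key _ _ (isRep_vec p) (isRep_vec q) hw h
  obtain ⟨P, Q, a, b, hab, hPQ, hR, hP, hQ⟩ := main
  have hint'' : T 0 ∩ T 1 = {a, b} := by
    rcases hab with ⟨rfl, rfl⟩ | ⟨rfl, rfl⟩
    · exact hint'
    · rw [hint', Finset.pair_comm]
  have hsep' := (hT.crosses 0 (by omega) a b hint'').neg_of_isRep hP hQ hR (isRep_vec m)
  rw [det2_sub_right, det2_sub_left, det2_self, det2_self, hPQ] at hsep'
  have hm := eq_smul_add_smul (Or.inl hPQ) (vec m)
  rw [hPQ, one_mul, one_mul] at hm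
  have hpos : 0 < det2 P (vec m) * det2 (vec m) Q := by linarith
  obtain ⟨E, hE, k, l, hk, hl, hkl⟩ : ∃ E, IsRep E m ∧ ∃ k l : ℤ, 0 < k ∧ 0 < l ∧
      E = k • P + l • Q := by
    rcases pos_and_pos_or_neg_and_neg_of_mul_pos hpos with ⟨h1, h2⟩ | ⟨h1, h2⟩
    · exact ⟨vec m, isRep_vec m, _, _, h2, h1, hm⟩
    · refine ⟨-vec m, (isRep_vec m).neg, -det2 (vec m) Q, -det2 P (vec m), by omega, by omega, ?_⟩
      rw [neg_smul, neg_smul, ← neg_add, ← hm]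
  have hm' : ∀ j, (j = 0 ∨ j = 1) → ∀ x, x ∈ ({a, b} : Finset Slope) → x ∈ T j := by
    intro j hj x hx
    rw [← hint''] at hx
    rcases hj with rfl | rfl
    · exact (Finset.mem_inter.1 hx).1
    · exact (Finset.mem_inter.1 hx).2
  have hne : a ≠ b := by rcases hab with ⟨rfl, rfl⟩ | ⟨rfl, rfl⟩; exacts [hpq, hpq.symm]
  refine ⟨P, Q, E, a, b, hab, hPQ, hR, hE, hP, hQ, hint'', Or.inl hPQ,
    ⟨1, 0, by simp, by simp, by simp, by simp⟩, ⟨0, 1, by simp, by simp, by simp, by simp⟩,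
    ⟨k, l, hk, hl, hkl⟩, ?_⟩
  obtain ⟨c, hc, hca, hcb, hrep⟩ := (hT.triangle 1 (by omega)).exists_third
    (hm' 1 (Or.inr rfl) a (by simp)) (hm' 1 (Or.inr rfl) b (by simp)) hne hP hQ
  refine ⟨c, ?_, hc, hca, hcb⟩
  rcases hrep with h | h
  · exact h
  · exfalso
    have hcr : c = r := h.unique hR
    have := hT.once 0 (by omega) 1 (by omega) (by
      rw [hc, hcr, hT.start]
      rcases hab with ⟨rfl, rfl⟩ | ⟨rfl, rfl⟩
      · rfl
      · rw [Finset.insert_comm])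
    omega

/-- A positively oriented pair of vectors `P, Q` of the slopes `p, q`, in one of the two orders,
such that `P - Q` is a vector of `r` and a vector `E` of `m` lies in the open cone spanned by `P, Q`. It
is unique up to a change of all signs. -/
structure FareyBasis (p q r m : Slope) (P Q E : ℤ × ℤ) : Prop where
  det_eq : det2 P Q = 1
  rep : (IsRep P p ∧ IsRep Q q) ∨ (IsRep P q ∧ IsRep Q p)
  rep_sub : IsRep (P - Q) r
  rep_meridian : IsRep E m
  cone : ∃ k l : ℤ, 0 < k ∧ 0 < l ∧ E = k • P + l • Q

lemma FareyBasis.neg {p q r m : Slope} {P Q E : ℤ × ℤ} (h : FareyBasis p q r m P Q E) :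
    FareyBasis p q r m (-P) (-Q) (-E) where
  det_eq := by rw [det2_neg_left, det2_neg_right, neg_neg, h.det_eq]
  rep := h.rep.imp (fun h => ⟨h.1.neg, h.2.neg⟩) (fun h => ⟨h.1.neg, h.2.neg⟩)
  rep_sub := by rw [← neg_sub']; exact h.rep_sub.neg
  rep_meridian := h.rep_meridian.neg
  cone := by
    obtain ⟨k, l, hk, hl, e⟩ := h.cone
    exact ⟨k, l, hk, hl, by rw [e, smul_neg, smul_neg, neg_add]⟩

/-- The vector `w` lies in the closed cone spanned by `P, Q`, and the meridian vector is
`E = A w + B (w + y)`, with positive `A, B`, for another vector `y` of the cone. -/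
def IsPivotVec (P Q E w : ℤ × ℤ) : Prop :=
  (∃ w₁ w₂ : ℤ, 0 ≤ w₁ ∧ 0 ≤ w₂ ∧ 0 < w₁ + w₂ ∧ w = w₁ • P + w₂ • Q) ∧
  ∃ y₁ y₂ A B : ℤ, 0 ≤ y₁ ∧ 0 ≤ y₂ ∧ 0 < y₁ + y₂ ∧ 0 < A ∧ 0 < B ∧
    E = A • w + B • (w + (y₁ • P + y₂ • Q))

lemma IsPivotVec.neg {P Q E w : ℤ × ℤ} (h : IsPivotVec P Q E w) :
    IsPivotVec (-P) (-Q) (-E) (-w) := by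
  obtain ⟨⟨w₁, w₂, h1, h2, h3, e⟩, y₁, y₂, A, B, h4, h5, h6, h7, h8, e'⟩ := h
  refine ⟨⟨w₁, w₂, h1, h2, h3, ?_⟩, y₁, y₂, A, B, h4, h5, h6, h7, h8, ?_⟩
  · rw [e]; simp only [smul_neg, neg_add]
  · rw [e', smul_neg, smul_neg, smul_neg, ← neg_add, ← neg_add, smul_neg, ← neg_add]

/-- The pivots of a Farey path in terms of vectors: if a pivot is on the left (right) of the path,
then its vector in the cone is counterclockwise (clockwise) from the meridian vector. -/
lemma IsFareyPath.exists_pivot {p q r m : Slope} {N : ℕ} {T : ℕ → Finset Slope}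
    (hT : IsFareyPath p q r m N T) :
    ∃ P Q E : ℤ × ℤ, FareyBasis p q r m P Q E ∧
      ∀ i x, 1 ≤ i → i ≤ N - 1 → x ∈ T (i - 1) → x ∈ T i → x ∈ T (i + 1) →
        ∃ w : ℤ × ℤ, IsRep w x ∧ IsPivotVec P Q E w ∧
          (CarriesL r m T i → 0 < det2 E w) ∧ (CarriesR r m T i → det2 E w < 0) := by
  obtain ⟨P, Q, E, a, b, hab, hPQ, hR, hE, h0⟩ := hT.exists_basis
  refine ⟨P, Q, E, ⟨hPQ, ?_, hR, hE, h0.between⟩, ?_⟩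
  · rcases hab with ⟨rfl, rfl⟩ | ⟨rfl, rfl⟩
    exacts [Or.inl ⟨h0.repA, h0.repB⟩, Or.inr ⟨h0.repA, h0.repB⟩]
  have hall : ∀ i < N, ∃ A B a b, FareyEdge P Q E T i A B a b := by
    intro i
    induction i with
    | zero => exact fun _ => ⟨_, _, _, _, h0⟩
    | succ i ih =>
      intro hi
      obtain ⟨A, B, a, b, h⟩ := ih (by omega)
      obtain ⟨A', B', a', b', c', -, h', -⟩ := h.step hT hPQ hR hE hi
      exact ⟨_, _, _, _, h'⟩
  intro i x hi hiN hx0 hx1 hx2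
  obtain ⟨j, rfl⟩ : ∃ j, i = j + 1 := ⟨i - 1, by omega⟩
  rw [Nat.add_sub_cancel] at hx0
  have hN := hT.two_le
  obtain ⟨A₀, B₀, a₀, b₀, h⟩ := hall j (by omega)
  obtain ⟨A, B, a, b, c, h, h', hbc⟩ := h.step hT hPQ hR hE (i := j) (by omega)
  have huniq : ∀ z, z ∈ T j ∩ T (j + 1) → z ∈ T (j + 1) ∩ T (j + 2) → z = a := by
    intro z hz hz'
    rw [h.inter] at hz
    rw [h'.inter] at hz'
    simp only [Finset.mem_insert, Finset.mem_singleton] at hz hz'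
    rcases hz with h | rfl
    · exact h
    · rcases hz' with h | h
      · exact h
      · exact absurd h hbc
  have hxa : x = a := huniq x (Finset.mem_inter.2 ⟨hx0, hx1⟩) (Finset.mem_inter.2 ⟨hx1, hx2⟩)
  subst hxa
  have hdet : 0 < det2 E (P - Q) * det2 A (P - Q) := by
    refine mul_pos_of_neg_of_neg (det2_cone_left hPQ ?_) (det2_cone_left hPQ h.coneA)
    obtain ⟨k, l, hk, hl, e⟩ := h0.between
    exact ⟨k, l, hk.le, hl.le, by omega, e⟩
  have hpiv : IsPivotVec P Q E A := by
    obtain ⟨y₁, y₂, h1, h2, h3, rfl⟩ := h.coneB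
    obtain ⟨k, l, hk, hl, e⟩ := h'.between
    exact ⟨h.coneA, y₁, y₂, k, l, h1, h2, h3, hk, hl, e⟩
  refine ⟨A, h.repA, hpiv, ?_, ?_⟩
  · rintro ⟨z, hz, hz', hleft⟩
    rw [huniq z hz hz', IsLeftEnd, ccw_iff hE h.repA hR, det2_comm (P - Q) E] at hleft
    by_contra hneg
    push Not at hneg
    nlinarith
  · rintro ⟨z, hz, hz', hright⟩
    rw [huniq z hz hz', IsRightEnd, ccw_iff hR h.repA hE, det2_comm (P - Q) A, det2_comm A E]
      at hright
    by_contra hneg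
    push Not at hneg
    nlinarith

/-! ### The orbit of the base point -/

lemma coe_phi (α : ℂˣ) : (phi α : Matrix (Fin 2) (Fin 2) ℂ) = !![(α : ℂ), 0; 0, 1] := rfl

lemma phi_mul (α β : ℂˣ) : phi (α * β) = phi α * phi β := by
  ext i j
  rw [Matrix.GeneralLinearGroup.coe_mul, coe_phi, coe_phi, coe_phi]
  fin_cases i <;> fin_cases j <;> simp

lemma phi_zpow (α : ℂˣ) (n : ℤ) : phi α ^ n = phi (α ^ n) :=
  (map_zpow (MonoidHom.mk' phi phi_mul) α n).symm

lemma mobius_phi (α : ℂˣ) (y : E3) :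
    mobius (phi α) y =
      !₂[2 * ((α : ℂ) * ((y 0 : ℂ) + (y 1 : ℂ) * Complex.I)).re /
            (Complex.normSq α * (1 + y 2) + (1 - y 2)),
         2 * ((α : ℂ) * ((y 0 : ℂ) + (y 1 : ℂ) * Complex.I)).im /
            (Complex.normSq α * (1 + y 2) + (1 - y 2)),
         (Complex.normSq α * (1 + y 2) - (1 - y 2)) /
            (Complex.normSq α * (1 + y 2) + (1 - y 2))] := by
  have h : (phi α : Matrix (Fin 2) (Fin 2) ℂ) * herm y * (phi α : Matrix (Fin 2) (Fin 2) ℂ)ᴴ =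
      !![((Complex.normSq α * (1 + y 2) : ℝ) : ℂ), (α : ℂ) * ((y 0 : ℂ) + (y 1 : ℂ) * Complex.I);
        ((y 0 : ℂ) - (y 1 : ℂ) * Complex.I) * (starRingEnd ℂ α), ((1 - y 2 : ℝ) : ℂ)] := by
    rw [coe_phi, herm]
    ext i j
    fin_cases i <;> fin_cases j <;>
      simp [Matrix.mul_apply, Fin.sum_univ_two, Complex.normSq_eq_conj_mul_self]
    ring
  simp only [mobius, h]
  have ht : (!![((Complex.normSq α * (1 + y 2) : ℝ) : ℂ),
      (α : ℂ) * ((y 0 : ℂ) + (y 1 : ℂ) * Complex.I);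
        ((y 0 : ℂ) - (y 1 : ℂ) * Complex.I) * (starRingEnd ℂ α), ((1 - y 2 : ℝ) : ℂ)]).trace.re =
      Complex.normSq α * (1 + y 2) + (1 - y 2) := by
    rw [Matrix.trace_fin_two]
    simp only [Matrix.of_apply, Matrix.cons_val', Matrix.cons_val_zero, Matrix.cons_val_one,
      Matrix.cons_val_fin_one, Complex.add_re, Complex.ofReal_re]
  rw [ht]
  simp only [Matrix.of_apply, Matrix.cons_val', Matrix.cons_val_zero, Matrix.cons_val_one,
      Matrix.cons_val_fin_one, Complex.sub_re, Complex.ofReal_re]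

/-- The point of the unit sphere with stereographic coordinate `z`. -/
noncomputable def stereoPt (z : ℂ) : E3 :=
  !₂[2 * z.re / (Complex.normSq z + 1), 2 * z.im / (Complex.normSq z + 1),
    (Complex.normSq z - 1) / (Complex.normSq z + 1)]

@[simp] lemma stereoPt_zero_coord (z : ℂ) : stereoPt z 0 = 2 * z.re / (Complex.normSq z + 1) := rfl
@[simp] lemma stereoPt_one_coord (z : ℂ) : stereoPt z 1 = 2 * z.im / (Complex.normSq z + 1) := rfl
@[simp] lemma stereoPt_two_coord (z : ℂ) :
    stereoPt z 2 = (Complex.normSq z - 1) / (Complex.normSq z + 1) := rfl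

lemma normSq_add_one_pos (z : ℂ) : 0 < Complex.normSq z + 1 := by
  have := Complex.normSq_nonneg z; linarith

lemma orbitPt_eq (α : ℂˣ) (n : ℤ) : orbitPt α n = stereoPt ((α : ℂ) ^ n) := by
  rw [orbitPt, phi_zpow, mobius_phi, stereoPt]
  simp [basePt]

lemma stereoPt_one : stereoPt 1 = basePt := by
  ext i; fin_cases i <;> norm_num [stereoPt, basePt]

lemma orbitPt_zero (α : ℂˣ) : orbitPt α 0 = basePt := by
  rw [orbitPt_eq, zpow_zero, stereoPt_one]

lemma norm_sq_eq (y : E3) : ‖y‖ ^ 2 = y 0 ^ 2 + y 1 ^ 2 + y 2 ^ 2 := by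
  rw [EuclideanSpace.real_norm_sq_eq, Fin.sum_univ_three]

lemma norm_stereoPt (z : ℂ) : ‖stereoPt z‖ = 1 := by
  have h := normSq_add_one_pos z
  have : ‖stereoPt z‖ ^ 2 = 1 := by
    rw [norm_sq_eq, stereoPt_zero_coord, stereoPt_one_coord, stereoPt_two_coord]
    field_simp
    rw [Complex.normSq_apply]; ring
  have h0 := norm_nonneg (stereoPt z)
  nlinarith

lemma norm_orbitPt (α : ℂˣ) (n : ℤ) : ‖orbitPt α n‖ = 1 := by
  rw [orbitPt_eq, norm_stereoPt]

lemma normSq_zpow (α : ℂˣ) (n : ℤ) :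
    Complex.normSq ((α : ℂ) ^ n) = (Complex.normSq (α : ℂ)) ^ n := map_zpow₀ _ _ _

lemma one_lt_normSq {α : ℂˣ} (hα : 1 < ‖(α : ℂ)‖) : 1 < Complex.normSq (α : ℂ) := by
  rw [Complex.normSq_eq_norm_sq]; nlinarith

lemma stereoPt_two_mono {z w : ℂ} (h : Complex.normSq z ≤ Complex.normSq w) :
    stereoPt z 2 ≤ stereoPt w 2 := by
  have hz := normSq_add_one_pos z
  have hw := normSq_add_one_pos w
  rw [stereoPt_two_coord, stereoPt_two_coord, div_le_div_iff₀ hz hw]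
  nlinarith

lemma orbitPt_two_mono {α : ℂˣ} (hα : 1 < ‖(α : ℂ)‖) {n k : ℤ} (h : n ≤ k) :
    orbitPt α n 2 ≤ orbitPt α k 2 := by
  rw [orbitPt_eq, orbitPt_eq]
  apply stereoPt_two_mono
  rw [normSq_zpow, normSq_zpow]
  exact zpow_le_zpow_right₀ (one_lt_normSq hα).le h

lemma orbitPt_two_pos {α : ℂˣ} (hα : 1 < ‖(α : ℂ)‖) {n : ℤ} (h : 0 < n) : 0 < orbitPt α n 2 := by
  rw [orbitPt_eq, stereoPt_two_coord, normSq_zpow]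
  have := one_lt_zpow₀ (one_lt_normSq hα) h
  apply div_pos <;> linarith

lemma orbitPt_two_neg {α : ℂˣ} (hα : 1 < ‖(α : ℂ)‖) {n : ℤ} (h : n < 0) : orbitPt α n 2 < 0 := by
  rw [orbitPt_eq, stereoPt_two_coord, normSq_zpow]
  have h1 := zpow_lt_one_of_neg₀ (one_lt_normSq hα) h
  have h2 : 0 < Complex.normSq (α : ℂ) ^ n := zpow_pos (by linarith [one_lt_normSq hα]) _
  apply div_neg_of_neg_of_pos <;> linarith

/-- A linear functional that is bounded by `k` on the orbit is bounded by `k` at the poles, which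
are the accumulation points of the orbit. -/
lemma pole_le_of_forall_orbitPt_le {α : ℂˣ} (hα : 1 < ‖(α : ℂ)‖) {a b c k : ℝ}
    (h : ∀ n, a * orbitPt α n 0 + b * orbitPt α n 1 + c * orbitPt α n 2 ≤ k) :
    c ≤ k ∧ -c ≤ k := by
  have key : ∀ z : ℂ, a * stereoPt z 0 + b * stereoPt z 1 + c * stereoPt z 2 ≤ k ↔
      2 * (a * z.re + b * z.im) + c * (Complex.normSq z - 1) ≤ k * (Complex.normSq z + 1) := by
    intro z
    have hz := normSq_add_one_pos z
    have : a * stereoPt z 0 + b * stereoPt z 1 + c * stereoPt z 2 =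
      (2 * (a * z.re + b * z.im) + c * (Complex.normSq z - 1)) / (Complex.normSq z + 1) := by
      simp only [stereoPt_zero_coord, stereoPt_one_coord, stereoPt_two_coord]; field_simp
    rw [this, div_le_iff₀ hz]
  have hr : 1 < ‖(α : ℂ)‖ := hα
  have hlim : ∀ (s : ℝ),
      (∀ n : ℕ, s ≤ (‖(α : ℂ)‖ ^ n)⁻¹ * (2 * (|a| + |b|) + |c| + |k|)) → s ≤ 0 := by
    intro s hs
    have h1 : Filter.Tendsto (fun n : ℕ => (‖(α : ℂ)‖ ^ n)⁻¹ * (2 * (|a| + |b|) + |c| + |k|))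
        Filter.atTop (𝓝 (0 * (2 * (|a| + |b|) + |c| + |k|))) :=
      ((tendsto_pow_atTop_atTop_of_one_lt hr).inv_tendsto_atTop).mul_const _
    rw [zero_mul] at h1
    exact ge_of_tendsto' h1 hs
  have hab : ∀ z : ℂ, |a * z.re + b * z.im| ≤ (|a| + |b|) * ‖z‖ := by
    intro z
    calc |a * z.re + b * z.im| ≤ |a * z.re| + |b * z.im| := abs_add_le _ _
      _ ≤ |a| * ‖z‖ + |b| * ‖z‖ := by
        rw [abs_mul, abs_mul]
        gcongr
        · exact Complex.abs_re_le_norm z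
        · exact Complex.abs_im_le_norm z
      _ = _ := by ring
  constructor
  · have := hlim (c - k) (fun n => by
      have h1 := (key _).1 ((orbitPt_eq α n) ▸ h n)
      have h2 := hab ((α : ℂ) ^ (n : ℤ))
      rw [abs_le] at h2
      have h3 : ‖(α : ℂ) ^ (n : ℤ)‖ = ‖(α : ℂ)‖ ^ n := by simp
      rw [Complex.normSq_eq_norm_sq, h3] at h1
      rw [h3] at h2
      have h4 : 1 ≤ ‖(α : ℂ)‖ ^ n := one_le_pow₀ hr.le
      set x := ‖(α : ℂ)‖ ^ n
      have hx : 0 < x := by linarith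
      rw [inv_mul_eq_div, le_div_iff₀ hx]
      have h5 : (c - k) * x ^ 2 ≤ 2 * (|a| + |b|) * x + |c| + |k| := by
        nlinarith [le_abs_self c, le_abs_self k]
      have h6 : |c| + |k| ≤ (|c| + |k|) * x := le_mul_of_one_le_right (by positivity) h4
      have h7 : ((c - k) * x) * x ≤ (2 * (|a| + |b|) + |c| + |k|) * x := by nlinarith
      exact le_of_mul_le_mul_right h7 hx)
    linarith
  · have := hlim (-c - k) (fun n => by
      have h1 := (key _).1 ((orbitPt_eq α (-n)) ▸ h (-n))
      have h2 := hab ((α : ℂ) ^ (-n : ℤ))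
      rw [abs_le] at h2
      have h3 : ‖(α : ℂ) ^ (-n : ℤ)‖ = (‖(α : ℂ)‖ ^ n)⁻¹ := by simp
      rw [Complex.normSq_eq_norm_sq, h3] at h1
      rw [h3] at h2
      have h4 : (‖(α : ℂ)‖ ^ n)⁻¹ ≤ 1 := inv_le_one_of_one_le₀ (one_le_pow₀ hr.le)
      have h5 : 0 < (‖(α : ℂ)‖ ^ n)⁻¹ := by positivity
      set x := (‖(α : ℂ)‖ ^ n)⁻¹
      have h6 : x ^ 2 ≤ x := by nlinarith
      nlinarith [neg_abs_le c, neg_abs_le k, le_abs_self c, le_abs_self k, abs_nonneg c,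
        abs_nonneg k,
        mul_le_mul_of_nonneg_left h6 (abs_nonneg c), mul_le_mul_of_nonneg_left h6 (abs_nonneg k),
        mul_le_mul_of_nonneg_right (neg_abs_le c) (sq_nonneg x),
        mul_le_mul_of_nonneg_right (le_abs_self k) (sq_nonneg x)])
    linarith

/-- The powers of a nonreal number are not contained in a half-plane. -/
lemma eq_zero_of_forall_re_mul_zpow_nonneg {u d : ℂ} (hu : u.im ≠ 0)
    (h : ∀ n : ℕ, 0 ≤ (d * u ^ n).re) : d = 0 := by
  have hu0 : u ≠ 0 := by rintro rfl; simp at hu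
  have hn : 0 < ‖u‖ := norm_pos_iff.2 hu0
  -- Normalize to the unit circle, where the partial sums of the geometric series are bounded.
  set ω : ℂ := u / ‖u‖ with hω
  have hωn : ‖ω‖ = 1 := by rw [hω, norm_div, Complex.norm_real, norm_norm, div_self hn.ne']
  have hωim : ω.im ≠ 0 := by
    rw [hω, Complex.div_ofReal_im]; exact div_ne_zero hu hn.ne'
  have hω1 : ω ≠ 1 := by intro h; rw [h] at hωim; simp at hωim
  have hpos : ∀ n : ℕ, 0 ≤ (d * ω ^ n).re := by
    intro n
    have : d * ω ^ n = (d * u ^ n) / ((‖u‖ ^ n : ℝ) : ℂ) := by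
      rw [hω, div_pow, mul_div_assoc]; push_cast; rfl
    rw [this, Complex.div_ofReal_re]
    exact div_nonneg (h n) (by positivity)
  have hsum : Summable fun n : ℕ => (d * ω ^ n).re := by
    refine summable_of_sum_range_le (c := ‖d‖ * (2 / ‖ω - 1‖)) hpos ?_
    intro n
    rw [← Complex.re_sum, ← Finset.mul_sum, geom_sum_eq hω1]
    refine (Complex.re_le_norm _).trans ?_
    rw [norm_mul, norm_div]
    gcongr
    calc ‖ω ^ n - 1‖ ≤ ‖ω ^ n‖ + ‖(1 : ℂ)‖ := norm_sub_le _ _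
      _ = 2 := by rw [norm_pow, hωn, one_pow, norm_one]; norm_num
  have h0 := hsum.tendsto_atTop_zero
  have h1 : Filter.Tendsto (fun n : ℕ => (d * ω ^ (n + 1)).re) Filter.atTop (𝓝 0) :=
    h0.comp (Filter.tendsto_add_atTop_nat 1)
  have h2 : ∀ n : ℕ, (d * ω ^ n).im = (ω.re * (d * ω ^ n).re - (d * ω ^ (n + 1)).re) / ω.im := by
    intro n
    rw [pow_succ, ← mul_assoc, Complex.mul_re (d * ω ^ n) ω]
    field_simp
    ring
  have h3 : Filter.Tendsto (fun n : ℕ => (d * ω ^ n).im) Filter.atTop (𝓝 0) := by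
    simp only [h2]
    have := ((h0.const_mul ω.re).sub h1).div_const ω.im
    simpa using this
  have h4 : Filter.Tendsto (fun n : ℕ => (d * ω ^ n).re ^ 2 + (d * ω ^ n).im ^ 2)
      Filter.atTop (𝓝 0) := by
    simpa using (h0.pow 2).add (h3.pow 2)
  have h5 : ∀ n : ℕ, (d * ω ^ n).re ^ 2 + (d * ω ^ n).im ^ 2 = ‖d‖ ^ 2 := by
    intro n
    have : ‖d‖ = ‖d * ω ^ n‖ := by rw [norm_mul, norm_pow, hωn, one_pow, mul_one]
    rw [this, ← Complex.normSq_eq_norm_sq, Complex.normSq_apply]; ring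
  simp only [h5] at h4
  have := tendsto_nhds_unique h4 tendsto_const_nhds
  exact norm_eq_zero.1 (by nlinarith [norm_nonneg d])

/-! ### The hull of the orbit -/

lemma continuousLinearMap_apply (f : E3 →L[ℝ] ℝ) (y : E3) :
    f y = f (EuclideanSpace.single 0 1) * y 0 + f (EuclideanSpace.single 1 1) * y 1 +
      f (EuclideanSpace.single 2 1) * y 2 := by
  have : y = y 0 • EuclideanSpace.single 0 (1 : ℝ) + y 1 • EuclideanSpace.single 1 (1 : ℝ) +
      y 2 • EuclideanSpace.single 2 (1 : ℝ) := by
    ext i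
    fin_cases i <;> simp [Fin.ext_iff]
  conv_lhs => rw [this]
  simp only [map_add, map_smul, smul_eq_mul]
  ring

lemma convex_hull (α : ℂˣ) : Convex ℝ (hull α) :=
  (convex_convexHull ℝ _).inter (convex_ball 0 1)

lemma interior_hull (α : ℂˣ) :
    interior (hull α) = interior (convexHull ℝ (range (orbitPt α))) ∩ Metric.ball 0 1 := by
  rw [hull, interior_inter, Metric.isOpen_ball.interior_eq]

/-- The open axis is in the interior of `U`. -/
lemma axis_mem_interior_hull {α : ℂˣ} (hα : 1 < ‖(α : ℂ)‖) (him : (α : ℂ).im ≠ 0)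
    (hne : (interior (convexHull ℝ (range (orbitPt α)))).Nonempty) {y : E3} (h0 : y 0 = 0)
    (h1 : y 1 = 0) (h2 : |y 2| < 1) : y ∈ interior (hull α) := by
  set C := convexHull ℝ (range (orbitPt α)) with hC
  have hconv : Convex ℝ C := convex_convexHull ℝ _
  rw [interior_hull]
  refine ⟨?_, ?_⟩
  · by_contra hy
    obtain ⟨f, hf⟩ := geometric_hahn_banach_open_point hconv.interior isOpen_interior hy
    have hle : ∀ x ∈ closure C, f x ≤ f y := by
      intro x hx
      rw [← hconv.closure_interior_eq_closure_of_nonempty_interior hne] at hx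
      exact closure_minimal (fun z hz => (hf z hz).le)
        (isClosed_le f.continuous continuous_const) hx
    have horb : ∀ n, f (orbitPt α n) ≤ f y := fun n =>
      hle _ (subset_closure (subset_convexHull ℝ _ (mem_range_self n)))
    replace horb : ∀ n, f (EuclideanSpace.single 0 1) * orbitPt α n 0 +
        f (EuclideanSpace.single 1 1) * orbitPt α n 1 +
        f (EuclideanSpace.single 2 1) * orbitPt α n 2 ≤ f (EuclideanSpace.single 2 1) * y 2 := by
      intro n
      have := horb n
      rw [continuousLinearMap_apply f (orbitPt α n), continuousLinearMap_apply f y, h0, h1,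
        mul_zero, mul_zero, add_zero, zero_add] at this
      exact this
    obtain ⟨hp1, hp2⟩ := pole_le_of_forall_orbitPt_le hα horb
    rw [abs_lt] at h2
    set c := f (EuclideanSpace.single 2 1)
    have hc : c = 0 := by nlinarith
    have hd := eq_zero_of_forall_re_mul_zpow_nonneg him
      (d := ⟨-f (EuclideanSpace.single 0 1), f (EuclideanSpace.single 1 1)⟩) (fun n => by
        have := horb n
        rw [hc, zero_mul, zero_mul, add_zero, orbitPt_eq, stereoPt_zero_coord, stereoPt_one_coord,
          zpow_natCast] at this
        have hz := normSq_add_one_pos ((α : ℂ) ^ n)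
        have e : f (EuclideanSpace.single 0 1) * (2 * ((α : ℂ) ^ n).re /
            (Complex.normSq ((α : ℂ) ^ n) + 1)) + f (EuclideanSpace.single 1 1) *
            (2 * ((α : ℂ) ^ n).im / (Complex.normSq ((α : ℂ) ^ n) + 1)) =
            (2 * (f (EuclideanSpace.single 0 1) * ((α : ℂ) ^ n).re +
            f (EuclideanSpace.single 1 1) * ((α : ℂ) ^ n).im)) /
              (Complex.normSq ((α : ℂ) ^ n) + 1) := by field_simp
        rw [e, div_le_iff₀ hz] at this
        rw [Complex.mul_re]
        dsimp only
        linarith)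
    have hd0 := congrArg Complex.re hd
    have hd1 := congrArg Complex.im hd
    simp only [Complex.zero_re, Complex.zero_im, neg_eq_zero] at hd0 hd1
    obtain ⟨x, hx⟩ := hne
    have := hf x hx
    rw [continuousLinearMap_apply f x, continuousLinearMap_apply f y] at this
    change _ + _ + c * _ < _ + _ + c * _ at this
    rw [hd0, hd1, hc] at this
    simp at this
  · rw [mem_ball_zero_iff]
    have := norm_sq_eq y
    rw [h0, h1] at this
    have h3 : y 2 ^ 2 < 1 := by rw [sq_lt_one_iff_abs_lt_one]; exact h2
    nlinarith [norm_nonneg y]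

lemma orbitPt_mem_closure_hull {α : ℂˣ} (h0 : (0 : E3) ∈ interior (hull α)) (n : ℤ) :
    orbitPt α n ∈ closure (hull α) := by
  have h1 : openSegment ℝ (0 : E3) (orbitPt α n) ⊆ hull α := by
    intro y hy
    refine ⟨?_, ?_⟩
    · exact (convex_convexHull ℝ _).openSegment_subset (interior_subset h0).1
        (subset_convexHull ℝ _ (mem_range_self n)) hy
    · obtain ⟨a, b, ha, hb, hab, rfl⟩ := hy
      rw [mem_ball_zero_iff, smul_zero, zero_add, norm_smul, norm_orbitPt, Real.norm_eq_abs,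
        abs_of_pos hb]
      linarith
  exact closure_mono h1 (segment_subset_closure_openSegment (right_mem_segment ℝ _ _))

/-- A supporting plane of `U` at a point of its boundary. -/
lemma exists_support {α : ℂˣ} (h0 : (0 : E3) ∈ interior (hull α)) {x : E3}
    (hx : x ∈ frontier (hull α)) :
    ∃ f : E3 →L[ℝ] ℝ, 0 < f x ∧ ∀ n, f (orbitPt α n) ≤ f x := by
  obtain ⟨f, hf⟩ := geometric_hahn_banach_open_point (convex_hull α).interior isOpen_interior hx.2
  refine ⟨f, by simpa using hf 0 h0, fun n => ?_⟩
  have hn := orbitPt_mem_closure_hull h0 n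
  rw [← (convex_hull α).closure_interior_eq_closure_of_nonempty_interior ⟨0, h0⟩] at hn
  exact closure_minimal (fun z hz => (hf z hz).le) (isClosed_le f.continuous continuous_const) hn

/-- A point of the unit sphere whose height stays away from the heights of the orbit is not in the
closure of `U`. -/
lemma notMem_closure_hull {α : ℂˣ} {u : E3} (hu : ‖u‖ = 1) {δ : ℝ} (hδ : 0 < δ)
    (h : ∀ n, δ ≤ |u 2 - orbitPt α n 2|) : u ∉ closure (hull α) := by
  intro hmem
  have hsub : hull α ⊆ {y : E3 | inner ℝ u y ≤ 1 - δ ^ 2 / 2} := by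
    refine inter_subset_left.trans (convexHull_min ?_ ?_)
    · rintro _ ⟨n, rfl⟩
      have h1 : ‖u - orbitPt α n‖ ^ 2 = 2 - 2 * inner ℝ u (orbitPt α n) := by
        rw [norm_sub_sq_real, hu, norm_orbitPt]; ring
      have h2 : δ ^ 2 ≤ ‖u - orbitPt α n‖ ^ 2 := by
        rw [norm_sq_eq]
        have : δ ^ 2 ≤ ((u - orbitPt α n) 2) ^ 2 := by
          rw [← sq_abs ((u - orbitPt α n) 2)]
          exact pow_le_pow_left₀ hδ.le (h n) 2
        nlinarith [sq_nonneg ((u - orbitPt α n) 0), sq_nonneg ((u - orbitPt α n) 1)]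
      simp only [mem_ofPred_eq]
      linarith
    · exact convex_halfSpace_le (innerₛₗ ℝ u).isLinear _
  have := closure_minimal hsub (isClosed_le (by fun_prop) continuous_const) hmem
  simp only [mem_ofPred_eq, real_inner_self_eq_norm_sq, hu] at this
  nlinarith

lemma det3_eq (a b c : E3) : det3 a b c = a 0 * (b 1 * c 2 - b 2 * c 1) -
    a 1 * (b 0 * c 2 - b 2 * c 0) + a 2 * (b 0 * c 1 - b 1 * c 0) := by
  rw [det3, Matrix.det_fin_three]
  simp only [Matrix.of_apply, Matrix.cons_val_zero, Matrix.cons_val_one, Matrix.cons_val]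
  ring

/-- `D` times the sum of the barycentric coordinates of `y`, where `D = det3 a b c`: the points with
`planeForm a b c y = det3 a b c` are those of the plane through `a, b, c`. -/
noncomputable def planeForm (a b c y : E3) : ℝ := det3 y b c + det3 a y c + det3 a b y

/-- Cramer's rule. -/
lemma det3_smul_eq (a b c y : E3) :
    det3 a b c • y = det3 y b c • a + det3 a y c • b + det3 a b y • c := by
  simp only [det3_eq]
  ext i
  fin_cases i <;> simp <;> ring

/-- The unit ball is strictly convex: the centroid of a nondegenerate ideal triangle is not on the
sphere. -/
lemma eq_of_norm_centroid {u v w : E3} (hu : ‖u‖ = 1) (hv : ‖v‖ = 1) (hw : ‖w‖ = 1)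
    (hg : ‖(3⁻¹ : ℝ) • (u + v + w)‖ = 1) : u = v := by
  have h1 : ‖u + v + w‖ = 3 := by
    rw [norm_smul, Real.norm_eq_abs, abs_of_pos (by norm_num)] at hg
    linarith
  have h2 := norm_add_sq_real (u + v) w
  rw [inner_add_left, norm_add_sq_real u v, h1, hu, hv, hw] at h2
  have h3 := norm_sub_sq_real u v
  have h4 := norm_sub_sq_real u w
  have h5 := norm_sub_sq_real v w
  rw [hu, hv] at h3
  rw [hu, hw] at h4
  rw [hv, hw] at h5
  have h6 : ‖u - v‖ ^ 2 ≤ 0 := by nlinarith [sq_nonneg ‖u - w‖, sq_nonneg ‖v - w‖]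
  have h7 : ‖u - v‖ = 0 := by nlinarith [norm_nonneg (u - v)]
  exact sub_eq_zero.1 (norm_eq_zero.1 h7)

/-! ### Markings: vertices, edges and faces -/

namespace FareyBasis

variable {p q r m : Slope} {P Q E : ℤ × ℤ}

lemma isEdgeVec_iff (h : FareyBasis p q r m P Q E) (e : ℤ × ℤ) :
    IsEdgeVec p q r e ↔ e = P ∨ e = -P ∨ e = Q ∨ e = -Q ∨ e = P - Q ∨ e = Q - P := by
  have key : ∀ {f : ℤ × ℤ} {u : Slope}, IsRep f u → (IsRep e u ↔ e = f ∨ e = -f) := by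
    intro f u hf
    constructor
    · exact fun he => hf.eq_or_eq_neg he
    · rintro (rfl | rfl)
      · exact hf
      · exact hf.neg
  have hsub := key h.rep_sub
  rw [neg_sub] at hsub
  have h1 : IsEdgeVec p q r e ↔ IsRep e p ∨ IsRep e q ∨ IsRep e r := by
    constructor
    · rintro ⟨u, rfl | rfl | rfl, hu⟩
      exacts [Or.inl hu, Or.inr (Or.inl hu), Or.inr (Or.inr hu)]
    · rintro (hu | hu | hu)
      exacts [⟨p, Or.inl rfl, hu⟩, ⟨q, Or.inr (Or.inl rfl), hu⟩, ⟨r, Or.inr (Or.inr rfl), hu⟩]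
  rw [h1, hsub]
  rcases h.rep with ⟨hP, hQ⟩ | ⟨hP, hQ⟩ <;> rw [key hP, key hQ] <;> tauto

lemma isPlaneTriangle_PQ (h : FareyBasis p q r m P Q E) : IsPlaneTriangle p q r 0 P Q := by
  simp only [IsPlaneTriangle, h.isEdgeVec_iff, sub_zero, zero_sub]; tauto

lemma isPlaneTriangle_RP (h : FareyBasis p q r m P Q E) : IsPlaneTriangle p q r 0 (P - Q) P := by
  have : P - (P - Q) = Q := by abel
  simp only [IsPlaneTriangle, h.isEdgeVec_iff, sub_zero, zero_sub, this]; tauto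

lemma isPlaneTriangle_RQ (h : FareyBasis p q r m P Q E) :
    IsPlaneTriangle p q r 0 (P - Q) (-Q) := by
  have : -Q - (P - Q) = -P := by abel
  simp only [IsPlaneTriangle, h.isEdgeVec_iff, sub_zero, zero_sub, this, neg_neg]; tauto

end FareyBasis

lemma toPlane_zero : toPlane 0 = 0 := by simp [toPlane]

lemma toPlane_add (a b : ℤ × ℤ) : toPlane (a + b) = toPlane a + toPlane b := by
  simp [toPlane]

lemma toPlane_neg (a : ℤ × ℤ) : toPlane (-a) = -toPlane a := by
  simp [toPlane]

lemma toPlane_smul (k : ℤ) (a : ℤ × ℤ) : toPlane (k • a) = (k : ℝ) • toPlane a := by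
  simp [toPlane]

lemma toPlane_injective : Function.Injective toPlane := by
  intro a b h
  simp only [toPlane, Prod.mk.injEq, Int.cast_inj] at h
  exact Prod.ext h.1 h.2

namespace Marking

variable {α : ℂˣ} {p q r m : Slope}

lemma Ψ_add (M : Marking α p q r m) (x : ℝ × ℝ) (e : ℤ × ℤ) :
    M.Ψ (x + toPlane e) = mobius (phi α ^ M.deck e) (M.Ψ x) :=
  ((M.map_eq_iff x _ _).2 ⟨e, rfl, rfl⟩).symm

lemma Ψ_toPlane (M : Marking α p q r m) (e : ℤ × ℤ) : M.Ψ (toPlane e) = orbitPt α (M.deck e) := by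
  have := M.Ψ_add 0 e
  rwa [zero_add, M.map_zero] at this

lemma Ψ_mem_frontier (M : Marking α p q r m) {x : ℝ × ℝ} (hx : x ∉ range toPlane) :
    M.Ψ x ∈ frontier (hull α) :=
  (M.mapsTo x hx).1

lemma norm_Ψ_lt (M : Marking α p q r m) {x : ℝ × ℝ} (hx : x ∉ range toPlane) : ‖M.Ψ x‖ < 1 :=
  mem_ball_zero_iff.1 (M.mapsTo x hx).2

lemma deck_meridian (M : Marking α p q r m) {P Q E : ℤ × ℤ} (h : FareyBasis p q r m P Q E) :
    M.deck E = 0 := by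
  rcases h.rep_meridian with rfl | rfl
  · exact M.meridian
  · rw [map_neg, M.meridian, neg_zero]

lemma det3_pos (M : Marking α p q r m) {P Q E : ℤ × ℤ} (h : FareyBasis p q r m P Q E) :
    0 < det3 (orbitPt α 0) (orbitPt α (M.deck P)) (orbitPt α (M.deck Q)) := by
  have := M.orientation 0 P Q h.isPlaneTriangle_PQ (by rw [sub_zero, sub_zero, h.det_eq]; simp)
  rwa [M.Ψ_toPlane, M.Ψ_toPlane, M.Ψ_toPlane, _root_.map_zero] at this

lemma deck_smul_add (M : Marking α p q r m) {P Q : ℤ × ℤ} (k l : ℤ) :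
    M.deck (k • P + l • Q) = k * M.deck P + l * M.deck Q := by
  rw [map_add, map_zsmul, map_zsmul, smul_eq_mul, smul_eq_mul]

/-- The homomorphism `deck` vanishes on the meridian, and it is not zero: it has opposite signs at
the two ends of an edge crossed by the meridian. -/
lemma deck_neg_pos_or (M : Marking α p q r m) {P Q E : ℤ × ℤ} (h : FareyBasis p q r m P Q E) :
    (M.deck P < 0 ∧ 0 < M.deck Q) ∨ (0 < M.deck P ∧ M.deck Q < 0) := by
  obtain ⟨k, l, hk, hl, e⟩ := h.cone
  have h0 := M.deck_meridian h
  rw [e, deck_smul_add] at h0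
  rcases lt_trichotomy (M.deck P) 0 with h1 | h1 | h1
  · exact Or.inl ⟨h1, by nlinarith⟩
  · exfalso
    rw [h1, mul_zero, zero_add] at h0
    have h2 : M.deck Q = 0 := by
      rcases mul_eq_zero.1 h0 with h | h
      · omega
      · exact h
    have := M.det3_pos h
    rw [h1, h2, det3_eq] at this
    linarith
  · exact Or.inr ⟨h1, by nlinarith⟩

/-- If `α` were real, then the orbit would be contained in a plane through the axis. -/
lemma im_ne_zero (M : Marking α p q r m) {P Q E : ℤ × ℤ} (h : FareyBasis p q r m P Q E) :
    (α : ℂ).im ≠ 0 := by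
  intro him
  have hα : (α : ℂ) = ((α : ℂ).re : ℂ) := by apply Complex.ext <;> simp [him]
  have hz : ∀ n, orbitPt α n 1 = 0 := by
    intro n
    rw [orbitPt_eq, stereoPt_one_coord, hα, ← Complex.ofReal_zpow, Complex.ofReal_im]
    simp
  have := M.det3_pos h
  rw [det3_eq, hz, hz, hz] at this
  linarith

lemma interior_nonempty (M : Marking α p q r m) {P Q E : ℤ × ℤ} (h : FareyBasis p q r m P Q E) :
    (interior (convexHull ℝ (range (orbitPt α)))).Nonempty := by
  rw [interior_convexHull_nonempty_iff_affineSpan_eq_top]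
  have hne : P ≠ -Q := by
    intro hPQ
    have := h.det_eq
    rw [hPQ, det2_neg_left, det2_self] at this
    omega
  have hai := M.bent 0 (P - Q) P (-Q) h.isPlaneTriangle_RP h.isPlaneTriangle_RQ hne
    (by rw [sub_zero]; exact h.rep_sub)
  have htop := hai.affineSpan_eq_top_iff_card_eq_finrank_add_one.2 (by simp)
  rw [← top_le_iff, ← htop]
  apply affineSpan_mono
  rintro _ ⟨i, rfl⟩
  fin_cases i <;> simp [Ψ_toPlane]

lemma axis_mem_interior (M : Marking α p q r m) {P Q E : ℤ × ℤ} (h : FareyBasis p q r m P Q E)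
    (hα : 1 < ‖(α : ℂ)‖)
    {y : E3} (h0 : y 0 = 0) (h1 : y 1 = 0) (h2 : |y 2| < 1) : y ∈ interior (hull α) :=
  axis_mem_interior_hull hα (M.im_ne_zero h) (M.interior_nonempty h) h0 h1 h2

lemma zero_mem_interior (M : Marking α p q r m) {P Q E : ℤ × ℤ} (h : FareyBasis p q r m P Q E)
    (hα : 1 < ‖(α : ℂ)‖) :
    (0 : E3) ∈ interior (hull α) :=
  M.axis_mem_interior h hα rfl rfl (by simp)

/-- The plane of a face supports `U`. -/
lemma planeForm_le (M : Marking α p q r m) (h0 : (0 : E3) ∈ interior (hull α)) {a b c : ℤ × ℤ}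
    (h : IsPlaneTriangle p q r a b c) (hdet : 0 < det2 (b - a) (c - a)) (n : ℤ) :
    planeForm (M.Ψ (toPlane a)) (M.Ψ (toPlane b)) (M.Ψ (toPlane c)) (orbitPt α n) ≤
      det3 (M.Ψ (toPlane a)) (M.Ψ (toPlane b)) (M.Ψ (toPlane c)) := by
  have hD := M.orientation a b c h hdet
  have hface := M.face a b c h
  rw [M.Ψ_toPlane a, M.Ψ_toPlane b, M.Ψ_toPlane c] at *
  set u := orbitPt α (M.deck a) with hu
  set v := orbitPt α (M.deck b) with hv
  set w := orbitPt α (M.deck c) with hw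
  -- The centroid of the face is a boundary point in the open ball.
  set g : E3 := (3⁻¹ : ℝ) • (u + v + w) with hg
  have hgmem : g ∈ convexHull ℝ {u, v, w} := by
    have hs := (convex_convexHull ℝ {u, v, w})
    have hu' : u ∈ convexHull ℝ {u, v, w} := subset_convexHull ℝ _ (by simp)
    have hv' : v ∈ convexHull ℝ {u, v, w} := subset_convexHull ℝ _ (by simp)
    have hw' : w ∈ convexHull ℝ {u, v, w} := subset_convexHull ℝ _ (by simp)
    have h2 : (2⁻¹ : ℝ) • u + (2⁻¹ : ℝ) • v ∈ convexHull ℝ {u, v, w} :=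
      hs hu' hv' (by norm_num) (by norm_num) (by norm_num)
    have h3 := hs h2 hw' (a := 2 / 3) (b := 1 / 3) (by norm_num) (by norm_num) (by norm_num)
    convert h3 using 1
    rw [hg]; module
  rw [← hface] at hgmem
  obtain ⟨x, -, hx⟩ := hgmem
  have hxl : x ∉ range toPlane := by
    rintro ⟨e, rfl⟩
    rw [M.Ψ_toPlane] at hx
    have huv : u = v := eq_of_norm_centroid (norm_orbitPt _ _) (norm_orbitPt _ _)
      (norm_orbitPt _ _) (by rw [← hg, ← hx, norm_orbitPt])
    rw [det3_eq, huv] at hD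
    linarith
  have hfr := M.Ψ_mem_frontier hxl
  rw [hx] at hfr
  obtain ⟨f, hf, hle⟩ := exists_support h0 hfr
  have hfg : f g = 3⁻¹ * (f u + f v + f w) := by
    rw [hg, map_smul, map_add, map_add, smul_eq_mul]
  have h1 := hle (M.deck a)
  have h2 := hle (M.deck b)
  have h3 := hle (M.deck c)
  have hfu : f u = f g := by linarith
  have hfv : f v = f g := by linarith
  have hfw : f w = f g := by linarith
  have hc := congrArg f (det3_smul_eq u v w (orbitPt α n))
  simp only [map_add, map_smul, smul_eq_mul, hfu, hfv, hfw] at hc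
  have h4 := mul_le_mul_of_nonneg_left (hle n) hD.le
  rw [hc] at h4
  rw [planeForm]
  nlinarith

/-- The plane of a face of an `r`-edge does not contain the opposite vertex of the adjacent face. -/
lemma planeForm_lt (M : Marking α p q r m) (h0 : (0 : E3) ∈ interior (hull α)) {P Q E : ℤ × ℤ}
    (h : FareyBasis p q r m P Q E) :
    planeForm (orbitPt α 0) (orbitPt α (M.deck P - M.deck Q)) (orbitPt α (M.deck P))
        (orbitPt α (-M.deck Q)) <
      det3 (orbitPt α 0) (orbitPt α (M.deck P - M.deck Q)) (orbitPt α (M.deck P)) := by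
  have hdet : 0 < det2 (P - Q - 0) (P - 0) := by
    rw [sub_zero, sub_zero, det2_sub_left, det2_self, det2_comm Q P, h.det_eq]; norm_num
  have hle := M.planeForm_le h0 h.isPlaneTriangle_RP hdet (-M.deck Q)
  have hD := M.orientation _ _ _ h.isPlaneTriangle_RP hdet
  have hne : P ≠ -Q := by
    intro hPQ
    have := h.det_eq
    rw [hPQ, det2_neg_left, det2_self] at this
    omega
  have hai := M.bent 0 (P - Q) P (-Q) h.isPlaneTriangle_RP h.isPlaneTriangle_RQ hne
    (by rw [sub_zero]; exact h.rep_sub)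
  simp only [M.Ψ_toPlane, _root_.map_zero, map_sub, map_neg] at hle hD hai
  refine lt_of_le_of_ne hle ?_
  intro heq
  set a := orbitPt α 0
  set b := orbitPt α (M.deck P - M.deck Q)
  set c := orbitPt α (M.deck P)
  set d := orbitPt α (-M.deck Q)
  rw [planeForm] at heq
  have hw := affineIndependent_iff.1 hai Finset.univ
    ![det3 d b c, det3 a d c, det3 a b d, -det3 a b c]
    (by simp [Fin.sum_univ_four]; linarith)
    (by
      have := det3_smul_eq a b c d
      simp only [Fin.sum_univ_four, Matrix.cons_val_zero, Matrix.cons_val_one, Matrix.cons_val,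
        neg_smul]
      rw [this]; abel) 3 (Finset.mem_univ _)
  simp only [Matrix.cons_val, neg_eq_zero] at hw
  linarith

end Marking

/-! ### The faces at the base point and the real axis -/

/-- Let `A = (1 + Z) / (1 - Z)` and `B = (1 + U) / (1 - U)`, where `Z, U` are the stereographic
coordinates of two vertices of `U` of negative height (this normalization puts `v` at infinity and
the poles at `1, -1`). If `1` and `-1` lie on the inner side of the line through `A` and `-B`, and
the link of `v` is strictly convex at the vertex between `A` and `B`, then `A` and `B` are strictly
on different sides of the real axis. -/
lemma im_mul_im_neg_of_convex {a₁ a₂ b₁ b₂ : ℝ} (ha : 0 < a₁) (hb : 0 < b₁)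
    (h₁ : a₂ + b₂ ≤ a₂ * b₁ - a₁ * b₂) (h₂ : -(a₂ + b₂) ≤ a₂ * b₁ - a₁ * b₂)
    (h₃ : 0 < b₁ * b₂ * (a₁ ^ 2 - a₂ ^ 2 - 1) - a₁ * a₂ * (b₁ ^ 2 - b₂ ^ 2 - 1)) :
    a₂ * b₂ < 0 := by
  have key : ∀ a₁ a₂ b₁ b₂ : ℝ, 0 < a₁ → 0 < b₁ → 0 ≤ a₂ → 0 ≤ b₂ →
      a₂ + b₂ ≤ a₂ * b₁ - a₁ * b₂ →
      b₁ * b₂ * (a₁ ^ 2 - a₂ ^ 2 - 1) - a₁ * a₂ * (b₁ ^ 2 - b₂ ^ 2 - 1) ≤ 0 := by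
    intro a₁ a₂ b₁ b₂ ha hb ha' hb' h
    have h1 : b₂ * (a₁ + 1) ≤ a₂ * (b₁ - 1) := by linarith
    have h2 : a₁ * (b₁ + 1) * (b₂ * (a₁ + 1)) ≤ a₁ * (b₁ + 1) * (a₂ * (b₁ - 1)) :=
      mul_le_mul_of_nonneg_left h1 (by positivity)
    have h3 : a₁ * b₂ ≤ a₂ * b₁ := by nlinarith
    have h4 : (a₂ * b₂) * (a₁ * b₂) ≤ (a₂ * b₂) * (a₂ * b₁) :=
      mul_le_mul_of_nonneg_left h3 (by positivity)
    have h5 : 0 ≤ b₂ * (b₁ + a₁ ^ 2 + a₁ * b₁ + a₁) := by positivity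
    nlinarith
  by_contra hneg
  push Not at hneg
  rcases le_total 0 a₂ with h | h <;> rcases le_total 0 b₂ with h' | h'
  · exact absurd (key a₁ a₂ b₁ b₂ ha hb h h' h₁) (not_le.2 h₃)
  · rcases mul_nonneg_iff.1 hneg with ⟨-, h''⟩ | ⟨h'', -⟩
    · have : b₂ = 0 := le_antisymm h' h''
      exact absurd (key a₁ a₂ b₁ b₂ ha hb h h'' h₁) (not_le.2 h₃)
    · have : a₂ = 0 := le_antisymm h'' h
      have := key b₁ (-b₂) a₁ (-a₂) hb ha (by linarith) (by linarith) (by linarith)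
      linarith
  · rcases mul_nonneg_iff.1 hneg with ⟨h'', -⟩ | ⟨-, h''⟩
    · exact absurd (key a₁ a₂ b₁ b₂ ha hb h'' h' h₁) (not_le.2 h₃)
    · have := key b₁ (-b₂) a₁ (-a₂) hb ha (by linarith) (by linarith) (by linarith)
      linarith
  · have := key b₁ (-b₂) a₁ (-a₂) hb ha (by linarith) (by linarith) (by linarith)
    linarith

lemma stereoPt_inv {z : ℂ} (hz : z ≠ 0) :
    stereoPt z⁻¹ 0 = stereoPt z 0 ∧ stereoPt z⁻¹ 1 = -stereoPt z 1 ∧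
      stereoPt z⁻¹ 2 = -stereoPt z 2 := by
  have h := Complex.normSq_pos.2 hz
  have h1 := normSq_add_one_pos z
  have h2 : (Complex.normSq z)⁻¹ + 1 ≠ 0 := by positivity
  simp only [stereoPt_zero_coord, stereoPt_one_coord, stereoPt_two_coord, Complex.inv_re,
    Complex.inv_im, Complex.normSq_inv]
  refine ⟨?_, ?_, ?_⟩ <;> field_simp <;> ring

/-- The four-point determinant on the sphere is the imaginary part of a cross ratio. -/
lemma det3_sub_planeForm_stereoPt (z u : ℂ) :
    (det3 (stereoPt 1) (stereoPt (z * u)) (stereoPt z) -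
      planeForm (stereoPt 1) (stereoPt (z * u)) (stereoPt z) (stereoPt u)) *
      ((Complex.normSq (z * u) + 1) * (Complex.normSq z + 1) * (Complex.normSq u + 1)) =
    4 * (u * (1 - z) ^ 2 * starRingEnd ℂ (z * (1 - u) ^ 2)).im := by
  have h1 := normSq_add_one_pos z
  have h2 := normSq_add_one_pos u
  have h3 := normSq_add_one_pos (z * u)
  have h4 : (1 : ℂ).re = 1 := rfl
  have h5 : (1 : ℂ).im = 0 := rfl
  simp only [planeForm, det3_eq, stereoPt_zero_coord, stereoPt_one_coord, stereoPt_two_coord,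
    map_one, h4, h5]
  field_simp
  obtain ⟨x, y⟩ := z
  obtain ⟨s, t⟩ := u
  simp only [Complex.normSq_apply, pow_two, Complex.mul_re, Complex.mul_im, Complex.sub_re,
    Complex.sub_im, Complex.conj_re, Complex.conj_im, h4, h5]
  ring

lemma one_sub_normSq_pos {z : ℂ} (h : Complex.normSq z < 1) : 0 < Complex.normSq (1 - z) := by
  rw [Complex.normSq_pos, sub_ne_zero]
  rintro rfl
  simp at h

/-- The two vertices of negative height adjacent to `v` along the edges of slopes `p, q` are
strictly on different sides of the plane through `v` and the axis. -/
lemma im_mul_im_neg_of_planeForm {z u : ℂ} (hz : Complex.normSq z < 1) (hu : Complex.normSq u < 1)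
    (h₁ : stereoPt z 0 * stereoPt u⁻¹ 1 - stereoPt z 1 * stereoPt u⁻¹ 0 - stereoPt u⁻¹ 1 +
      stereoPt z 1 ≤ stereoPt z 1 * stereoPt u⁻¹ 2 - stereoPt z 2 * stereoPt u⁻¹ 1)
    (h₂ : -(stereoPt z 0 * stereoPt u⁻¹ 1 - stereoPt z 1 * stereoPt u⁻¹ 0 - stereoPt u⁻¹ 1 +
      stereoPt z 1) ≤ stereoPt z 1 * stereoPt u⁻¹ 2 - stereoPt z 2 * stereoPt u⁻¹ 1)
    (hu0 : u ≠ 0)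
    (h₃ : planeForm (stereoPt 1) (stereoPt (z * u)) (stereoPt z) (stereoPt u) <
      det3 (stereoPt 1) (stereoPt (z * u)) (stereoPt z)) :
    z.im * u.im < 0 := by
  obtain ⟨e0, e1, e2⟩ := stereoPt_inv hu0
  rw [e0, e1, e2] at h₁ h₂
  have hz1 := normSq_add_one_pos z
  have hu1 := normSq_add_one_pos u
  have hzu1 := normSq_add_one_pos (z * u)
  have hp := one_sub_normSq_pos hz
  have hq := one_sub_normSq_pos hu
  have h3 : 0 < (u * (1 - z) ^ 2 * starRingEnd ℂ (z * (1 - u) ^ 2)).im := by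
    have := mul_pos (sub_pos.2 h₃) (mul_pos (mul_pos hzu1 hz1) hu1)
    rw [det3_sub_planeForm_stereoPt] at this
    linarith
  set X := Complex.normSq z with hX
  set Y := Complex.normSq u with hY
  set p := Complex.normSq (1 - z) with hpdef
  set q := Complex.normSq (1 - u) with hqdef
  have hp' : p = X - 2 * z.re + 1 := by
    rw [hpdef, hX, Complex.normSq_apply, Complex.normSq_apply]; simp; ring
  have hq' : q = Y - 2 * u.re + 1 := by
    rw [hqdef, hY, Complex.normSq_apply, Complex.normSq_apply]; simp; ring
  simp only [stereoPt_zero_coord, stereoPt_one_coord, stereoPt_two_coord] at h₁ h₂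
  rw [← hX, ← hY] at h₁ h₂
  have hD : (2 * z.im / p) * ((1 - Y) / q) - ((1 - X) / p) * (2 * u.im / q) =
      (2 * z.im / (X + 1) * -((Y - 1) / (Y + 1)) - (X - 1) / (X + 1) * -(2 * u.im / (Y + 1))) *
        ((X + 1) * (Y + 1) / (p * q)) := by
    field_simp; ring
  have hA : 2 * z.im / p + 2 * u.im / q =
      (2 * z.re / (X + 1) * -(2 * u.im / (Y + 1)) - 2 * z.im / (X + 1) * (2 * u.re / (Y + 1)) -
        -(2 * u.im / (Y + 1)) + 2 * z.im / (X + 1)) * ((X + 1) * (Y + 1) / (p * q)) := by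
    field_simp; rw [hp', hq']; ring
  have hc : 0 ≤ (X + 1) * (Y + 1) / (p * q) := by positivity
  have hfin := im_mul_im_neg_of_convex (a₁ := (1 - X) / p) (a₂ := 2 * z.im / p)
    (b₁ := (1 - Y) / q) (b₂ := 2 * u.im / q) (div_pos (by linarith) hp) (div_pos (by linarith) hq)
    (by rw [hD, hA]; exact mul_le_mul_of_nonneg_right h₁ hc)
    (by rw [hD, hA, ← neg_mul]; exact mul_le_mul_of_nonneg_right h₂ hc)
    (by
      have : (1 - Y) / q * (2 * u.im / q) *
          (((1 - X) / p) ^ 2 - (2 * z.im / p) ^ 2 - 1) - (1 - X) / p * (2 * z.im / p) *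
          (((1 - Y) / q) ^ 2 - (2 * u.im / q) ^ 2 - 1) =
          8 * (u * (1 - z) ^ 2 * starRingEnd ℂ (z * (1 - u) ^ 2)).im / (p * q) ^ 2 := by
        field_simp
        rw [hp', hq', hX, hY]
        obtain ⟨x, y⟩ := z
        obtain ⟨s, t⟩ := u
        have h4 : (1 : ℂ).re = 1 := rfl
        have h5 : (1 : ℂ).im = 0 := rfl
        simp only [Complex.normSq_apply, pow_two, Complex.mul_re, Complex.mul_im, Complex.sub_re,
          Complex.sub_im, Complex.conj_re, Complex.conj_im, h4, h5]
        ring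
      rw [this]
      positivity)
  have h6 : 2 * z.im / p * (2 * u.im / q) = z.im * u.im * (4 / (p * q)) := by field_simp; ring
  rw [h6] at hfin
  have h7 : 0 < 4 / (p * q) := by positivity
  by_contra hneg
  push Not at hneg
  nlinarith [mul_nonneg hneg h7.le]

namespace Marking

variable {α : ℂˣ} {p q r m : Slope}

/-- The ends of the edges of slopes `p, q` that start at `v` and enclose the meridian are strictly
on the same side of the plane through `v` and the axis. -/
lemma im_mul_im_pos (M : Marking α p q r m) {P Q E : ℤ × ℤ} (h : FareyBasis p q r m P Q E)
    (hα : 1 < ‖(α : ℂ)‖) :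
    0 < ((α : ℂ) ^ M.deck P).im * ((α : ℂ) ^ M.deck Q).im := by
  have hα0 : (α : ℂ) ≠ 0 := α.ne_zero
  -- The sign of `z⁻¹.im` is opposite to that of `z.im`.
  have hinv : ∀ n : ℤ, ∃ c : ℝ, 0 < c ∧ ((α : ℂ) ^ (-n)).im = -(c * ((α : ℂ) ^ n).im) := by
    intro n
    refine ⟨(Complex.normSq ((α : ℂ) ^ n))⁻¹,
      inv_pos.2 (Complex.normSq_pos.2 (zpow_ne_zero _ hα0)), ?_⟩
    rw [_root_.zpow_neg, Complex.inv_im, neg_div, div_eq_inv_mul]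
  have key : ∀ {P Q E : ℤ × ℤ}, FareyBasis p q r m P Q E → M.deck P < 0 → 0 < M.deck Q →
      0 < ((α : ℂ) ^ M.deck P).im * ((α : ℂ) ^ M.deck Q).im := by
    intro P Q E h hP hQ
    have h0 := M.zero_mem_interior h hα
    have hlt := M.planeForm_lt h0 h
    have hle := M.planeForm_le h0 h.isPlaneTriangle_PQ
      (by rw [sub_zero, sub_zero, h.det_eq]; norm_num)
    simp only [M.Ψ_toPlane, _root_.map_zero] at hle
    have e1 : (α : ℂ) ^ (M.deck P - M.deck Q) = (α : ℂ) ^ M.deck P * (α : ℂ) ^ (-M.deck Q) := by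
      rw [← zpow_add₀ hα0, sub_eq_add_neg]
    have e2 : (α : ℂ) ^ M.deck Q = ((α : ℂ) ^ (-M.deck Q))⁻¹ := by rw [_root_.zpow_neg, inv_inv]
    have hn : ∀ n : ℤ, n < 0 → Complex.normSq ((α : ℂ) ^ n) < 1 := by
      intro n hn
      rw [normSq_zpow]; exact zpow_lt_one_of_neg₀ (one_lt_normSq hα) hn
    set b := orbitPt α (M.deck P) with hb
    set c := orbitPt α (M.deck Q) with hc
    have hform : ∀ y, planeForm (orbitPt α 0) b c y =
        (b 1 * c 2 - b 2 * c 1) * y 0 + (c 2 - b 2 - (b 0 * c 2 - b 2 * c 0)) * y 1 +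
        (b 0 * c 1 - b 1 * c 0 - c 1 + b 1) * y 2 := by
      intro y
      rw [orbitPt_zero, planeForm, det3_eq, det3_eq, det3_eq]
      simp [basePt]; ring
    have hD : det3 (orbitPt α 0) b c = b 1 * c 2 - b 2 * c 1 := by
      rw [orbitPt_zero, det3_eq]
      simp [basePt]
    simp only [hform, hD] at hle
    obtain ⟨h1, h2⟩ := pole_le_of_forall_orbitPt_le hα hle
    rw [orbitPt_zero, ← stereoPt_one, orbitPt_eq, orbitPt_eq, hb, orbitPt_eq, e1] at hlt
    rw [hb, hc, orbitPt_eq, orbitPt_eq, e2] at h1 h2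
    have := im_mul_im_neg_of_planeForm (hn _ hP) (hn _ (neg_lt_zero.2 hQ)) h1 h2
      (zpow_ne_zero _ hα0) hlt
    obtain ⟨k, hk, e⟩ := hinv (M.deck Q)
    rw [e] at this
    nlinarith
  rcases M.deck_neg_pos_or h with ⟨h1, h2⟩ | ⟨h1, h2⟩
  · exact key h h1 h2
  · have := key h.neg (by rw [map_neg]; omega) (by rw [map_neg]; omega)
    rw [map_neg, map_neg] at this
    obtain ⟨k, hk, e⟩ := hinv (M.deck P)
    obtain ⟨l, hl, e'⟩ := hinv (M.deck Q)
    rw [e, e', neg_mul_neg] at this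
    have h3 : k * ((α : ℂ) ^ M.deck P).im * (l * ((α : ℂ) ^ M.deck Q).im) =
      (k * l) * (((α : ℂ) ^ M.deck P).im * ((α : ℂ) ^ M.deck Q).im) := by ring
    rw [h3] at this
    exact (mul_pos_iff_of_pos_left (mul_pos hk hl)).1 this

end Marking

/-! ### The longitude on the abelian cover -/

/-- The horizontal part of a point of space, as a complex number. -/
noncomputable def horiz (y : E3) : ℂ := ⟨y 0, y 1⟩

lemma continuous_horiz : Continuous horiz := by
  have : horiz = fun y : E3 => ((y 0 : ℝ) : ℂ) + ((y 1 : ℝ) : ℂ) * Complex.I := by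
    funext y; apply Complex.ext <;> simp [horiz]
  rw [this]; fun_prop

lemma horiz_smul (c : ℝ) (y : E3) : horiz (c • y) = c * horiz y := by
  apply Complex.ext <;> simp [horiz]

lemma horiz_add (x y : E3) : horiz (x + y) = horiz x + horiz y := by
  apply Complex.ext <;> simp [horiz]

lemma horiz_stereoPt (z : ℂ) :
    horiz (stereoPt z) = ((2 / (Complex.normSq z + 1) : ℝ) : ℂ) * z := by
  apply Complex.ext
  · rw [Complex.re_ofReal_mul]; simp only [horiz, stereoPt_zero_coord]; ring
  · rw [Complex.im_ofReal_mul]; simp only [horiz, stereoPt_one_coord]; ring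

lemma horiz_basePt : horiz basePt = 1 := by
  apply Complex.ext <;> simp [horiz, basePt]

lemma horiz_mobius_phi (α : ℂˣ) {y : E3} (hy : ‖y‖ ≤ 1) :
    ∃ c : ℝ, 0 < c ∧ horiz (mobius (phi α) y) = c * ((α : ℂ) * horiz y) := by
  have h2 : y 2 ^ 2 ≤ 1 := by
    have := norm_sq_eq y
    nlinarith [sq_nonneg (y 0), sq_nonneg (y 1), norm_nonneg y]
  obtain ⟨h3, h4⟩ := abs_le.1 ((sq_le_one_iff_abs_le_one _).1 h2)
  have h5 : 0 < Complex.normSq (α : ℂ) := Complex.normSq_pos.2 α.ne_zero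
  have h6 : 0 < Complex.normSq (α : ℂ) * (1 + y 2) + (1 - y 2) := by
    rcases h3.lt_or_eq with h | h
    · have := mul_pos h5 (by linarith : 0 < 1 + y 2)
      linarith
    · rw [← h]; norm_num
  refine ⟨2 / (Complex.normSq (α : ℂ) * (1 + y 2) + (1 - y 2)), by positivity, ?_⟩
  have h7 : horiz y = (y 0 : ℂ) + (y 1 : ℂ) * Complex.I := by
    apply Complex.ext <;> simp [horiz]
  rw [h7, mobius_phi]
  apply Complex.ext
  · rw [Complex.re_ofReal_mul]; simp only [horiz, Matrix.cons_val_zero]; ring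
  · rw [Complex.im_ofReal_mul]; simp only [horiz, Matrix.cons_val_one, Matrix.cons_val_zero]; ring

/-- Two continuous choices of an angle that agree at one point agree. -/
lemma eq_of_exp_mul_I_eq {X : Type*} [TopologicalSpace X] [PreconnectedSpace X] {f g : X → ℝ}
    (hf : Continuous f) (hg : Continuous g)
    (h : ∀ x, Complex.exp (f x * Complex.I) = Complex.exp (g x * Complex.I)) {a : X}
    (ha : f a = g a) : f = g := by
  refine Circle.isCoveringMap_exp.eq_of_comp_eq hf hg ?_ a ha
  funext x
  apply Circle.ext
  simp only [Function.comp_apply, Circle.coe_exp, h x]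

/-- Numbers on the same ray have the same angle. -/
lemma exp_mul_I_eq_of_ray {c d s t : ℝ} (hc : 0 < c) (hd : 0 < d)
    (h : (c : ℂ) * Complex.exp (s * Complex.I) = d * Complex.exp (t * Complex.I)) :
    Complex.exp (s * Complex.I) = Complex.exp (t * Complex.I) := by
  have h1 := congrArg norm h
  rw [norm_mul, norm_mul, Complex.norm_exp_ofReal_mul_I, Complex.norm_exp_ofReal_mul_I,
    Complex.norm_real, Complex.norm_real, Real.norm_of_nonneg hc.le, Real.norm_of_nonneg hd.le,
    mul_one, mul_one] at h1
  rw [h1] at h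
  exact mul_left_cancel₀ (Complex.ofReal_ne_zero.2 hd.ne') h

namespace Marking

variable {α : ℂˣ} {p q r m : Slope}

lemma norm_Ψ_le (M : Marking α p q r m) (x : ℝ × ℝ) : ‖M.Ψ x‖ ≤ 1 := by
  by_cases hx : x ∈ range toPlane
  · obtain ⟨e, rfl⟩ := hx
    rw [M.Ψ_toPlane, norm_orbitPt]
  · exact (M.norm_Ψ_lt hx).le

/-- The boundary of `U` does not meet the axis. -/
lemma horiz_Ψ_ne_zero (M : Marking α p q r m) {P Q E : ℤ × ℤ} (h : FareyBasis p q r m P Q E)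
    (hα : 1 < ‖(α : ℂ)‖) (x : ℝ × ℝ) : horiz (M.Ψ x) ≠ 0 := by
  by_cases hx : x ∈ range toPlane
  · obtain ⟨e, rfl⟩ := hx
    rw [M.Ψ_toPlane, orbitPt_eq, horiz_stereoPt]
    have := normSq_add_one_pos ((α : ℂ) ^ M.deck e)
    exact mul_ne_zero (Complex.ofReal_ne_zero.2 (by positivity)) (zpow_ne_zero _ α.ne_zero)
  · intro h0
    have e0 : M.Ψ x 0 = 0 := congrArg Complex.re h0
    have e1 : M.Ψ x 1 = 0 := congrArg Complex.im h0
    have hn := M.norm_Ψ_lt hx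
    have h2 : |M.Ψ x 2| < 1 := by
      have := norm_sq_eq (M.Ψ x)
      rw [e0, e1] at this
      rw [← sq_lt_one_iff_abs_lt_one]
      nlinarith [norm_nonneg (M.Ψ x)]
    exact (M.Ψ_mem_frontier hx).2 (M.axis_mem_interior h hα e0 e1 h2)

/-- `θ` is a continuous choice, on the abelian cover of the punctured torus, of the longitude of
points of `∂U`, with value `0` at the base point. -/
structure IsLongitude (M : Marking α p q r m) (θ : ℝ × ℝ → ℝ) : Prop where
  continuous : Continuous θ
  zero : θ 0 = 0
  ray : ∀ x, ∃ ρ : ℝ, 0 < ρ ∧ horiz (M.Ψ x) = ρ * Complex.exp (θ x * Complex.I)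

lemma exists_isLongitude (M : Marking α p q r m) {P Q E : ℤ × ℤ}
    (h : FareyBasis p q r m P Q E) (hα : 1 < ‖(α : ℂ)‖) : ∃ θ, M.IsLongitude θ := by
  obtain ⟨G, ⟨hG0, hG⟩, -⟩ := Complex.isCoveringMapOn_exp.existsUnique_continuousMap_lifts
    (⟨fun x => horiz (M.Ψ x), continuous_horiz.comp M.continuous_Ψ⟩ : C(ℝ × ℝ, ℂ))
    (a₀ := 0) (e₀ := 0) (by simp [M.map_zero, horiz_basePt])
    (fun x => M.horiz_Ψ_ne_zero h hα x)
  refine ⟨fun x => (G x).im, Complex.continuous_im.comp G.continuous, by simp [hG0], fun x =>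
    ⟨Real.exp (G x).re, Real.exp_pos _, ?_⟩⟩
  have := congrFun hG x
  simp only [Function.comp_apply, ContinuousMap.coe_mk] at this
  rw [← this, Complex.ofReal_exp, ← Complex.exp_add, Complex.re_add_im]

namespace IsLongitude

lemma add {M : Marking α p q r m} {θ : ℝ × ℝ → ℝ} (hθ : M.IsLongitude θ) (x : ℝ × ℝ) (e : ℤ × ℤ) :
    θ (x + toPlane e) = θ x + θ (toPlane e) := by
  have hc := hθ.continuous
  have key : (fun x => θ (x + toPlane e)) = fun x => θ x + θ (toPlane e) := by
    refine eq_of_exp_mul_I_eq (by fun_prop) (by fun_prop) (fun x => ?_) (a := 0)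
      (by rw [zero_add, hθ.zero, zero_add])
    obtain ⟨ρ, hρ, h1⟩ := hθ.ray x
    obtain ⟨σ, hσ, h2⟩ := hθ.ray (x + toPlane e)
    obtain ⟨τ, hτ, h3⟩ := hθ.ray (toPlane e)
    obtain ⟨c, hc, h4⟩ := horiz_mobius_phi (α ^ M.deck e) (M.norm_Ψ_le x)
    rw [← phi_zpow, ← M.Ψ_add, h1, h2] at h4
    rw [M.Ψ_toPlane, orbitPt_eq, horiz_stereoPt] at h3
    have hd : 0 < 2 / (Complex.normSq ((α : ℂ) ^ M.deck e) + 1) := by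
      have := normSq_add_one_pos ((α : ℂ) ^ M.deck e)
      positivity
    refine exp_mul_I_eq_of_ray (c := σ * (2 / (Complex.normSq ((α : ℂ) ^ M.deck e) + 1)))
      (d := c * ρ * τ) (by positivity) (by positivity) ?_
    rw [Complex.ofReal_add, add_mul, Complex.exp_add]
    calc _ = ((2 / (Complex.normSq ((α : ℂ) ^ M.deck e) + 1) : ℝ) : ℂ) *
          (σ * Complex.exp (θ (x + toPlane e) * Complex.I)) := by push_cast; ring
      _ = c * ρ * Complex.exp (θ x * Complex.I) *
          (((2 / (Complex.normSq ((α : ℂ) ^ M.deck e) + 1) : ℝ) : ℂ) * (α : ℂ) ^ M.deck e) := by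
        rw [h4, Units.val_zpow_eq_zpow_val]; ring
      _ = _ := by rw [h3]; push_cast; ring
  exact congrFun key x

lemma smul_add {M : Marking α p q r m} {θ : ℝ × ℝ → ℝ} (hθ : M.IsLongitude θ) (P Q : ℤ × ℤ)
    (k l : ℤ) : θ (toPlane (k • P + l • Q)) = k * θ (toPlane P) + l * θ (toPlane Q) := by
  let Θ : ℤ × ℤ →+ ℝ :=
    { toFun := fun e => θ (toPlane e)
      map_zero' := by rw [toPlane_zero, hθ.zero]
      map_add' := fun a b => by rw [toPlane_add, hθ.add] }
  change Θ (k • P + l • Q) = k * Θ P + l * Θ Q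
  rw [map_add, map_zsmul, map_zsmul, zsmul_eq_mul, zsmul_eq_mul]

lemma neg {M : Marking α p q r m} {θ : ℝ × ℝ → ℝ} (hθ : M.IsLongitude θ) (P : ℤ × ℤ) :
    θ (toPlane (-P)) = -θ (toPlane P) := by
  have := hθ.smul_add P 0 (-1) 0
  simpa [toPlane_zero, hθ.zero] using this

/-- The longitude of the vertex `φ ^ n (v)` is an argument of `α ^ n`. -/
lemma zpow_deck {M : Marking α p q r m} {θ : ℝ × ℝ → ℝ} (hθ : M.IsLongitude θ) (e : ℤ × ℤ) :
    ∃ ρ : ℝ, 0 < ρ ∧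
      (α : ℂ) ^ M.deck e = ρ * Complex.exp (θ (toPlane e) * Complex.I) := by
  obtain ⟨τ, hτ, h3⟩ := hθ.ray (toPlane e)
  rw [M.Ψ_toPlane, orbitPt_eq, horiz_stereoPt] at h3
  have h1 := normSq_add_one_pos ((α : ℂ) ^ M.deck e)
  refine ⟨(2 / (Complex.normSq ((α : ℂ) ^ M.deck e) + 1))⁻¹ * τ, by positivity, ?_⟩
  have h2 : ((2 / (Complex.normSq ((α : ℂ) ^ M.deck e) + 1) : ℝ) : ℂ) ≠ 0 :=
    Complex.ofReal_ne_zero.2 (by positivity)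
  rw [Complex.ofReal_mul, mul_assoc, ← h3, Complex.ofReal_inv, inv_mul_cancel_left₀ h2]

lemma im_zpow_deck {M : Marking α p q r m} {θ : ℝ × ℝ → ℝ} (hθ : M.IsLongitude θ) (e : ℤ × ℤ) :
    ∃ ρ : ℝ, 0 < ρ ∧ ((α : ℂ) ^ M.deck e).im = ρ * Real.sin (θ (toPlane e)) := by
  obtain ⟨ρ, hρ, h⟩ := hθ.zpow_deck e
  exact ⟨ρ, hρ, by rw [h, Complex.im_ofReal_mul, Complex.exp_ofReal_mul_I_im]⟩

/-- Along an edge from `v` the longitude varies by less than `π`: the edge is a chord that does not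
meet the axis. -/
lemma abs_lt_pi {M : Marking α p q r m} {θ : ℝ × ℝ → ℝ} (hθ : M.IsLongitude θ) {P Q E : ℤ × ℤ}
    (h : FareyBasis p q r m P Q E) (hα : 1 < ‖(α : ℂ)‖) {e : ℤ × ℤ} (he : IsEdgeVec p q r e) :
    |θ (toPlane e)| < Real.pi := by
  by_contra hcon
  push Not at hcon
  have hc := hθ.continuous
  have hedge := M.edge 0 e (by rwa [sub_zero])
  -- Otherwise the chord contains a point of longitude `π`, and `v` has longitude `0`.
  obtain ⟨t, ht, hpi⟩ : ∃ t ∈ Icc (0 : ℝ) 1, |θ (t • toPlane e)| = Real.pi := by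
    have hcont : ContinuousOn (fun t : ℝ => |θ (t • toPlane e)|) (Icc 0 1) := by fun_prop
    have := intermediate_value_Icc zero_le_one hcont
    exact this ⟨by simp [hθ.zero, Real.pi_pos.le], by simpa using hcon⟩
  obtain ⟨ρ, hρ, hray⟩ := hθ.ray (t • toPlane e)
  have hexp : Complex.exp (θ (t • toPlane e) * Complex.I) = -1 := by
    rcases (abs_eq Real.pi_pos.le).1 hpi with h | h <;> rw [h]
    · exact Complex.exp_pi_mul_I
    · rw [Complex.ofReal_neg, neg_mul, Complex.exp_neg, Complex.exp_pi_mul_I]; norm_num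
  rw [hexp] at hray
  have hmem : M.Ψ (t • toPlane e) ∈ segment ℝ (M.Ψ (toPlane 0)) (M.Ψ (toPlane e)) := by
    rw [← hedge]
    refine ⟨_, ?_, rfl⟩
    rw [toPlane_zero, segment_eq_image']
    exact ⟨t, ht, by simp⟩
  have hmem' : (ρ / (1 + ρ)) • M.Ψ (toPlane 0) + (1 / (1 + ρ)) • M.Ψ (t • toPlane e) ∈
      segment ℝ (M.Ψ (toPlane 0)) (M.Ψ (toPlane e)) :=
    convex_segment _ _ (left_mem_segment ℝ _ _) hmem (by positivity) (by positivity)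
      (by field_simp; ring)
  rw [← hedge] at hmem'
  obtain ⟨x, -, hx⟩ := hmem'
  apply M.horiz_Ψ_ne_zero h hα x
  rw [hx, horiz_add, horiz_smul, horiz_smul, hray, toPlane_zero, M.map_zero, horiz_basePt]
  push_cast
  ring

/-- Along the edges from `v` of slopes `p, q` that enclose the meridian, the longitude varies in the
same direction. -/
lemma same_sign {M : Marking α p q r m} {θ : ℝ × ℝ → ℝ} (hθ : M.IsLongitude θ) {P Q E : ℤ × ℤ}
    (h : FareyBasis p q r m P Q E) (hα : 1 < ‖(α : ℂ)‖) :
    (0 < θ (toPlane P) ∧ 0 < θ (toPlane Q)) ∨ (θ (toPlane P) < 0 ∧ θ (toPlane Q) < 0) := by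
  have hP := abs_lt.1 (hθ.abs_lt_pi h hα ((h.isEdgeVec_iff P).2 (by tauto)))
  have hQ := abs_lt.1 (hθ.abs_lt_pi h hα ((h.isEdgeVec_iff Q).2 (by tauto)))
  have him := M.im_mul_im_pos h hα
  obtain ⟨ρ, hρ, e1⟩ := hθ.im_zpow_deck P
  obtain ⟨σ, hσ, e2⟩ := hθ.im_zpow_deck Q
  have hpos : ∀ t : ℝ, -Real.pi < t → t < Real.pi → 0 < Real.sin t → 0 < t := by
    intro t h1 h2 h3
    by_contra hneg
    push Not at hneg
    linarith [Real.sin_nonpos_of_nonpos_of_neg_pi_le hneg h1.le]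
  have hneg : ∀ t : ℝ, -Real.pi < t → t < Real.pi → Real.sin t < 0 → t < 0 := by
    intro t h1 h2 h3
    by_contra hneg
    push Not at hneg
    linarith [Real.sin_nonneg_of_nonneg_of_le_pi hneg h2.le]
  rw [e1, e2] at him
  rcases pos_and_pos_or_neg_and_neg_of_mul_pos him with ⟨h1, h2⟩ | ⟨h1, h2⟩
  · exact Or.inl ⟨hpos _ hP.1 hP.2 ((mul_pos_iff_of_pos_left hρ).1 h1),
      hpos _ hQ.1 hQ.2 ((mul_pos_iff_of_pos_left hσ).1 h2)⟩
  · exact Or.inr ⟨hneg _ hP.1 hP.2 ((pos_iff_neg_of_mul_neg h1).1 hρ),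
      hneg _ hQ.1 hQ.2 ((pos_iff_neg_of_mul_neg h2).1 hσ)⟩

/-- The longitude integral of a curve from `v` on `∂U` is the value of the longitude function. -/
lemma hasLongitudeIntegral_iff {M : Marking α p q r m} {θ : ℝ × ℝ → ℝ} (hθ : M.IsLongitude θ)
    (w : ℤ × ℤ) (l : ℝ) :
    HasLongitudeIntegral (fun t => centralProj (M.Ψ (t • toPlane w))) l ↔
      l = θ (toPlane w) := by
  have hc := hθ.continuous
  have hray : ∀ t : ℝ, ∃ ρ : ℝ, 0 < ρ ∧ centralProj (M.Ψ (t • toPlane w)) 0 =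
      ρ * Real.cos (θ (t • toPlane w)) ∧ centralProj (M.Ψ (t • toPlane w)) 1 =
      ρ * Real.sin (θ (t • toPlane w)) := by
    intro t
    obtain ⟨ρ, hρ, h⟩ := hθ.ray (t • toPlane w)
    have hne : M.Ψ (t • toPlane w) ≠ 0 := by
      intro h0
      have h1 : horiz (0 : E3) = 0 := by apply Complex.ext <;> simp [horiz]
      rw [h0, h1] at h
      exact mul_ne_zero (Complex.ofReal_ne_zero.2 hρ.ne') (Complex.exp_ne_zero _) h.symm
    have h0 : M.Ψ (t • toPlane w) 0 = ρ * Real.cos (θ (t • toPlane w)) := by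
      have := congrArg Complex.re h
      rwa [Complex.re_ofReal_mul, Complex.exp_ofReal_mul_I_re] at this
    have h1 : M.Ψ (t • toPlane w) 1 = ρ * Real.sin (θ (t • toPlane w)) := by
      have := congrArg Complex.im h
      rwa [Complex.im_ofReal_mul, Complex.exp_ofReal_mul_I_im] at this
    refine ⟨‖M.Ψ (t • toPlane w)‖⁻¹ * ρ, mul_pos (inv_pos.2 (norm_pos_iff.2 hne)) hρ, ?_, ?_⟩
    · rw [centralProj, PiLp.smul_apply, smul_eq_mul, h0, mul_assoc]
    · rw [centralProj, PiLp.smul_apply, smul_eq_mul, h1, mul_assoc]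
  constructor
  · rintro ⟨θ', hcont, hθ', rfl⟩
    have hexp : ∀ t ∈ Icc (0 : ℝ) 1, Complex.exp (θ' t * Complex.I) =
        Complex.exp (θ (t • toPlane w) * Complex.I) := by
      intro t ht
      obtain ⟨ρ, hρ, h1, h2⟩ := hθ' t ht
      obtain ⟨σ, hσ, h3, h4⟩ := hray t
      refine exp_mul_I_eq_of_ray hρ hσ ?_
      apply Complex.ext
      · rw [Complex.re_ofReal_mul, Complex.exp_ofReal_mul_I_re, Complex.re_ofReal_mul,
          Complex.exp_ofReal_mul_I_re, ← h1, ← h3]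
      · rw [Complex.im_ofReal_mul, Complex.exp_ofReal_mul_I_im, Complex.im_ofReal_mul,
          Complex.exp_ofReal_mul_I_im, ← h2, ← h4]
    have h0 : Complex.exp (θ' 0 * Complex.I) = 1 := by
      rw [hexp 0 (by simp), zero_smul, hθ.zero]; simp
    have : PreconnectedSpace (Icc (0 : ℝ) 1) :=
      Subtype.preconnectedSpace isPreconnected_Icc
    have key : (fun t : Icc (0 : ℝ) 1 => θ' t) =
        fun t : Icc (0 : ℝ) 1 => θ ((t : ℝ) • toPlane w) + θ' 0 := by
      refine eq_of_exp_mul_I_eq (continuousOn_iff_continuous_domRestrict.1 hcont) (by fun_prop)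
        (fun t => ?_) (a := ⟨0, by simp⟩) (by simp [hθ.zero])
      rw [hexp t t.2, Complex.ofReal_add, add_mul, Complex.exp_add, h0, mul_one]
    have := congrFun key ⟨1, by simp⟩
    simp only [one_smul] at this
    rw [this]; ring
  · rintro rfl
    exact ⟨fun t => θ (t • toPlane w), by fun_prop, fun t _ => hray t, by simp [hθ.zero]⟩

end IsLongitude

end Marking

/-! ### The longitude of the meridian -/

/-- A horizontal loop on `∂U` around the axis, at a height that avoids the orbit. -/
lemma exists_loop {α : ℂˣ} (hα : 1 < ‖(α : ℂ)‖) (h0 : (0 : E3) ∈ interior (hull α)) :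
    ∃ u : ℝ → bdry α, Continuous u ∧ u (2 * Real.pi) = u 0 ∧
      ∀ t, ∃ ρ : ℝ, 0 < ρ ∧ horiz (u t) = ρ * Complex.exp (t * Complex.I) := by
  have hz1 : 0 < orbitPt α 1 2 := orbitPt_two_pos hα one_pos
  have hz1' : orbitPt α 1 2 ≤ 1 := by
    have := norm_sq_eq (orbitPt α 1)
    rw [norm_orbitPt] at this
    nlinarith [sq_nonneg (orbitPt α 1 0), sq_nonneg (orbitPt α 1 1)]
  set c := orbitPt α 1 2 / 2 with hc
  set s := Real.sqrt (1 - c ^ 2) with hs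
  have hs2 : s ^ 2 = 1 - c ^ 2 := Real.sq_sqrt (by nlinarith)
  have hspos : 0 < s := Real.sqrt_pos.2 (by nlinarith)
  let dir : ℝ → E3 := fun t => !₂[s * Real.cos t, s * Real.sin t, c]
  have hdir : Continuous dir := by
    refine (PiLp.continuous_toLp 2 _).comp (continuous_pi fun i => ?_)
    fin_cases i <;> simp <;> fun_prop
  have hnorm : ∀ t, ‖dir t‖ = 1 := by
    intro t
    have : ‖dir t‖ ^ 2 = 1 := by
      rw [norm_sq_eq]
      change (s * Real.cos t) ^ 2 + (s * Real.sin t) ^ 2 + c ^ 2 = 1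
      nlinarith [Real.sin_sq_add_cos_sq t]
    nlinarith [norm_nonneg (dir t)]
  have hnhds : hull α ∈ 𝓝 (0 : E3) := mem_interior_iff_mem_nhds.1 h0
  have hconv := convex_hull α
  have hgpos : ∀ t, 0 < gauge (hull α) (dir t) := by
    intro t
    rw [gauge_pos (absorbent_nhds_zero hnhds)
      ((NormedSpace.isVonNBounded_iff ℝ).2 (Metric.isBounded_ball.subset inter_subset_right))]
    exact norm_ne_zero_iff.1 (by rw [hnorm]; exact one_ne_zero)
  have hgcont : Continuous fun t => gauge (hull α) (dir t) :=
    (continuous_gauge hconv hnhds).comp hdir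
  have hfr : ∀ t, (gauge (hull α) (dir t))⁻¹ • dir t ∈ frontier (hull α) := by
    intro t
    rw [← gauge_eq_one_iff_mem_frontier hconv hnhds, gauge_smul_of_nonneg
      (inv_nonneg.2 (hgpos t).le), smul_eq_mul, inv_mul_cancel₀ (hgpos t).ne']
  have hball : ∀ t, (gauge (hull α) (dir t))⁻¹ • dir t ∈ Metric.ball (0 : E3) 1 := by
    intro t
    have hcl := (hfr t).1
    have hle : ‖(gauge (hull α) (dir t))⁻¹ • dir t‖ ≤ 1 := by
      rw [← mem_closedBall_zero_iff]
      exact closure_minimal (inter_subset_right.trans Metric.ball_subset_closedBall)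
        Metric.isClosed_closedBall hcl
    rw [mem_ball_zero_iff]
    refine lt_of_le_of_ne hle fun heq => ?_
    rw [norm_smul, hnorm, mul_one, Real.norm_of_nonneg (inv_nonneg.2 (hgpos t).le)] at heq
    rw [heq, one_smul] at hcl
    refine notMem_closure_hull (hnorm t) (δ := c) (by positivity) (fun n => ?_) hcl
    change c ≤ |c - orbitPt α n 2|
    rcases le_or_gt n 0 with hn | hn
    · have h1 := orbitPt_two_mono hα hn
      have h2 : orbitPt α 0 2 = 0 := by rw [orbitPt_zero]; simp [basePt]
      rw [h2] at h1
      exact le_trans (by linarith) (le_abs_self _)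
    · have h1 := orbitPt_two_mono hα (Int.add_one_le_of_lt hn)
      rw [zero_add] at h1
      exact le_trans (by linarith) (neg_le_abs _)
  refine ⟨fun t => ⟨_, hfr t, hball t⟩, ?_, ?_, ?_⟩
  · exact Continuous.subtype_mk ((hgcont.inv₀ fun t => (hgpos t).ne').smul hdir) _
  · have : dir (2 * Real.pi) = dir 0 := by simp [dir]
    exact Subtype.ext (by simp only [this])
  · intro t
    refine ⟨(gauge (hull α) (dir t))⁻¹ * s, mul_pos (inv_pos.2 (hgpos t)) hspos, ?_⟩
    change horiz ((gauge (hull α) (dir t))⁻¹ • dir t) = _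
    have : horiz (dir t) = s * Complex.exp (t * Complex.I) := by
      apply Complex.ext
      · rw [Complex.re_ofReal_mul, Complex.exp_ofReal_mul_I_re]; rfl
      · rw [Complex.im_ofReal_mul, Complex.exp_ofReal_mul_I_im]; rfl
    rw [horiz_smul, this, Complex.ofReal_mul, mul_assoc]

namespace Marking

variable {α : ℂˣ} {p q r m : Slope}

/-- The kernel of `deck` is generated by the meridian, which is primitive. -/
lemma exists_smul_of_deck_eq_zero (M : Marking α p q r m) {P Q E : ℤ × ℤ}
    (h : FareyBasis p q r m P Q E) {e : ℤ × ℤ} (he : M.deck e = 0) : ∃ j : ℤ, e = j • E := by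
  obtain ⟨k, l, hk, hl, hE⟩ := h.cone
  have h0 := M.deck_meridian h
  have hxy := eq_smul_add_smul (Or.inl h.det_eq) e
  set x := det2 P Q * det2 e Q
  set y := det2 P Q * det2 P e
  rw [hxy, M.deck_smul_add] at he
  rw [hE, M.deck_smul_add] at h0
  have hP : M.deck P ≠ 0 := by rcases M.deck_neg_pos_or h with h | h <;> omega
  have h1 : x * l = y * k := mul_right_cancel₀ hP (by linear_combination l * he - y * h0)
  have hcop : IsCoprime k l := by
    obtain ⟨u, v, huv⟩ := isCoprime_of_isRep h.rep_meridian
    refine ⟨u * P.1 + v * P.2, u * Q.1 + v * Q.2, ?_⟩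
    rw [← huv, hE]
    simp only [Prod.fst_add, Prod.snd_add, Prod.smul_fst, Prod.smul_snd, smul_eq_mul]
    ring
  obtain ⟨j, hj⟩ : k ∣ x := hcop.dvd_of_dvd_mul_right ⟨y, by rw [h1, mul_comm]⟩
  refine ⟨j, ?_⟩
  have h2 : y = j * l := mul_right_cancel₀ hk.ne' (by rw [← h1, hj]; ring)
  rw [hxy, hE, smul_add, smul_smul, smul_smul, ← h2, hj, mul_comm k j]

/-- The meridian winds once around the axis. If its longitude were `2 k π`, then the function
`exp (i θ / k)` would descend to a continuous `k`-th root of the longitude on `∂U`, which contains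
loops that wind once around the axis. -/
lemma IsLongitude.meridian_eq {M : Marking α p q r m} {θ : ℝ × ℝ → ℝ} (hθ : M.IsLongitude θ)
    {P Q E : ℤ × ℤ} (h : FareyBasis p q r m P Q E) (hα : 1 < ‖(α : ℂ)‖)
    (hpos : 0 < θ (toPlane E)) : θ (toPlane E) = 2 * Real.pi := by
  have h0 := M.zero_mem_interior h hα
  -- The longitude of the meridian is `2 k π`.
  obtain ⟨k, hk0, hk⟩ : ∃ k : ℕ, 0 < k ∧ θ (toPlane E) = 2 * Real.pi * k := by
    obtain ⟨ρ, hρ, h1⟩ := hθ.zpow_deck E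
    rw [M.deck_meridian h, zpow_zero] at h1
    have h2 := exp_mul_I_eq_of_ray (s := θ (toPlane E)) (t := 0) hρ one_pos (by rw [← h1]; simp)
    rw [Complex.ofReal_zero, zero_mul, Complex.exp_zero, Complex.exp_eq_one_iff] at h2
    obtain ⟨n, hn⟩ := h2
    have h3 : θ (toPlane E) = n * (2 * Real.pi) := by
      have := congrArg Complex.im hn
      simpa using this
    have hn0 : 0 < n := by
      have h4 : (0 : ℝ) < n := by
        by_contra hneg
        push Not at hneg
        nlinarith [Real.pi_pos]
      exact_mod_cast h4
    refine ⟨n.toNat, by omega, ?_⟩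
    have h5 : ((n.toNat : ℕ) : ℝ) = n := by
      have : ((n.toNat : ℕ) : ℤ) = n := Int.toNat_of_nonneg hn0.le
      exact_mod_cast this
    rw [h3, h5]; ring
  have hkR : (k : ℝ) ≠ 0 := by exact_mod_cast hk0.ne'
  have hkC : (k : ℂ) ≠ 0 := by exact_mod_cast hk0.ne'
  -- The continuous `k`-th root of the longitude.
  have hq := M.isQuotientMap
  set π : {x : ℝ × ℝ // x ∉ range toPlane} → bdry α := fun x => ⟨M.Ψ x, M.mapsTo x x.2⟩ with hπ
  have hsurj : Function.Surjective π := hq.surjective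
  let φ : ℝ × ℝ → ℂ := fun x => Complex.exp ((θ x / k : ℝ) * Complex.I)
  let g : bdry α → ℂ := fun u => φ (Function.surjInv hsurj u).1
  have hgπ : ∀ x, g (π x) = φ x := by
    intro x
    have hx := Function.surjInv_eq hsurj (π x)
    set y := Function.surjInv hsurj (π x) with hy
    have hx' : M.Ψ x = M.Ψ y := (congrArg Subtype.val hx).symm
    obtain ⟨e, he, hye⟩ := (M.map_eq_iff x y 0).1 (by
      rw [zpow_zero, ← hx', ← zpow_zero (phi α), ← M.deck.map_zero, ← M.Ψ_add, toPlane_zero,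
        add_zero])
    obtain ⟨j, rfl⟩ := M.exists_smul_of_deck_eq_zero h he
    change φ y = φ x
    have h1 : θ (toPlane (j • E)) = j * θ (toPlane E) := by
      have := hθ.smul_add E 0 j 0
      simpa using this
    have h2 : (θ y / k : ℝ) = θ x / k + j * (2 * Real.pi) := by
      rw [hye, hθ.add, h1, hk]; field_simp
    simp only [φ]
    rw [h2, Complex.exp_eq_exp_iff_exists_int]
    exact ⟨j, by push_cast; ring⟩
  have hgcont : Continuous g := by
    rw [hq.continuous_iff]
    have : g ∘ π = fun x : {x : ℝ × ℝ // x ∉ range toPlane} => φ x := funext hgπ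
    rw [this]
    have := hθ.continuous
    fun_prop
  obtain ⟨u, hu, hu2, hray⟩ := exists_loop hα h0
  let G : ℝ → ℂ := fun t => g (u t) * Complex.exp (-(t / k : ℝ) * Complex.I)
  have hGcont : Continuous G := by
    have := hgcont.comp hu
    fun_prop
  have hGk : ∀ t, G t ^ k = 1 := by
    intro t
    obtain ⟨x, hx⟩ := hsurj (u t)
    obtain ⟨ρ, hρ, h1⟩ := hray t
    obtain ⟨σ, hσ, h2⟩ := hθ.ray x
    have h3 : horiz (u t) = horiz (M.Ψ x) := by rw [← hx]
    rw [h1, h2] at h3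
    have h4 := exp_mul_I_eq_of_ray hρ hσ h3
    have h5 : φ x ^ k = Complex.exp (θ x * Complex.I) := by
      simp only [φ]
      rw [← Complex.exp_nat_mul]
      congr 1; push_cast; field_simp
    have h6 : Complex.exp (-(t / k : ℝ) * Complex.I) ^ k = (Complex.exp (t * Complex.I))⁻¹ := by
      rw [← Complex.exp_nat_mul, ← Complex.exp_neg]
      congr 1; push_cast; field_simp
    simp only [G]
    rw [mul_pow, h6, ← hx, hgπ, h5, h4, mul_inv_cancel₀ (Complex.exp_ne_zero _)]
  -- A continuous function with values in the `k`-th roots of unity is constant.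
  have hGconst : G (2 * Real.pi) = G 0 := by
    by_contra hne
    have hinf := (isPreconnected_range hGcont).infinite_of_nontrivial
      ⟨_, mem_range_self _, _, mem_range_self _, hne⟩
    refine hinf (((Polynomial.nthRootsFinset k (1 : ℂ)).finite_toSet).subset ?_)
    rintro _ ⟨t, rfl⟩
    exact (Polynomial.mem_nthRootsFinset hk0 _).2 (hGk t)
  simp only [G, hu2] at hGconst
  have hg0 : g (u 0) ≠ 0 := Complex.exp_ne_zero _
  have h1 := mul_left_cancel₀ hg0 hGconst
  rw [zero_div, Complex.ofReal_zero, neg_zero, zero_mul, Complex.exp_zero,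
    Complex.exp_eq_one_iff] at h1
  obtain ⟨n, hn⟩ := h1
  have h2 : -(2 * Real.pi / k) = n * (2 * Real.pi) := by
    have := congrArg Complex.im hn
    simpa using this
  have h3 : -((k : ℝ)⁻¹) = n := by
    have := Real.pi_pos
    field_simp at h2 ⊢
    linarith
  have h4 : k = 1 := by
    have h5 : (n : ℝ) * k = -1 := by rw [← h3]; field_simp
    have h6 : n * (k : ℤ) = -1 := by exact_mod_cast h5
    have h7 : (k : ℤ) ∣ 1 := ⟨-n, by linarith⟩
    exact_mod_cast Int.eq_one_of_dvd_one (by positivity) h7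
  rw [hk, h4, Nat.cast_one, mul_one]

end Marking

/-! ### The first triangle and the oriented lifts -/

lemma mem_convexHull_triple {V : Type*} [AddCommGroup V] [Module ℝ V] {a b c y : V} :
    y ∈ convexHull ℝ {a, b, c} ↔ ∃ s t u : ℝ, 0 ≤ s ∧ 0 ≤ t ∧ 0 ≤ u ∧ s + t + u = 1 ∧
      s • a + t • b + u • c = y := by
  constructor
  · intro hy
    rw [convexHull_insert (by simp), convexHull_pair, mem_convexJoin] at hy
    obtain ⟨a', ha', z, ⟨t, u, ht, hu, htu, rfl⟩, s, s', hs, hs', hss, rfl⟩ := hy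
    rw [mem_singleton_iff] at ha'
    subst ha'
    exact ⟨s, s' * t, s' * u, hs, by positivity, by positivity, by
      rw [add_assoc, ← mul_add, htu, mul_one, hss], by module⟩
  · rintro ⟨s, t, u, hs, ht, hu, hsum, rfl⟩
    have h := (convex_convexHull ℝ ({a, b, c} : Set V)).sum_mem (t := Finset.univ)
      (w := ![s, t, u]) (z := ![a, b, c])
      (by intro i _; fin_cases i <;> simpa)
      (by simp [Fin.sum_univ_three, hsum])
      (by intro i _; apply subset_convexHull; fin_cases i <;> simp)
    simpa [Fin.sum_univ_three] using h

/-- The linear form with value `1` at `P` and `Q`, when these span a unimodular parallelogram. -/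
def edgeForm (P Q : ℤ × ℤ) (z : ℝ × ℝ) : ℝ := z.1 * (Q.2 - P.2) + z.2 * (P.1 - Q.1)

lemma edgeForm_add (P Q : ℤ × ℤ) (z z' : ℝ × ℝ) :
    edgeForm P Q (z + z') = edgeForm P Q z + edgeForm P Q z' := by
  simp only [edgeForm, Prod.fst_add, Prod.snd_add]; ring

lemma edgeForm_smul (P Q : ℤ × ℤ) (c : ℝ) (z : ℝ × ℝ) :
    edgeForm P Q (c • z) = c * edgeForm P Q z := by
  simp only [edgeForm, Prod.smul_fst, Prod.smul_snd, smul_eq_mul]; ring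

lemma edgeForm_toPlane_left {P Q : ℤ × ℤ} (h : det2 P Q = 1) : edgeForm P Q (toPlane P) = 1 := by
  have h' : ((det2 P Q : ℤ) : ℝ) = 1 := by rw [h]; norm_num
  simp only [det2] at h'
  push_cast at h'
  simp only [edgeForm, toPlane]; linarith

lemma edgeForm_toPlane_right {P Q : ℤ × ℤ} (h : det2 P Q = 1) : edgeForm P Q (toPlane Q) = 1 := by
  have h' : ((det2 P Q : ℤ) : ℝ) = 1 := by rw [h]; norm_num
  simp only [det2] at h'
  push_cast at h'
  simp only [edgeForm, toPlane]; linarith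

lemma edgeForm_smul_add {P Q : ℤ × ℤ} (h : det2 P Q = 1) (k l : ℤ) :
    edgeForm P Q (toPlane (k • P + l • Q)) = k + l := by
  rw [toPlane_add, toPlane_smul, toPlane_smul, edgeForm_add, edgeForm_smul, edgeForm_smul,
    edgeForm_toPlane_left h, edgeForm_toPlane_right h, mul_one, mul_one]

namespace Marking

variable {α : ℂˣ} {p q r m : Slope}

lemma two_coord_pos_iff (M : Marking α p q r m) (hα : 1 < ‖(α : ℂ)‖) (e : ℤ × ℤ) :
    0 < M.Ψ (toPlane e) 2 ↔ 0 < M.deck e := by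
  rw [M.Ψ_toPlane]
  refine ⟨fun h => ?_, orbitPt_two_pos hα⟩
  by_contra hneg
  have h1 := orbitPt_two_mono hα (not_lt.1 hneg)
  have h2 : orbitPt α 0 2 = 0 := by rw [orbitPt_zero]; simp [basePt]
  linarith

lemma triangleAt_eq (M : Marking α p q r m) {a b : ℤ × ℤ} (h : IsPlaneTriangle p q r 0 a b) :
    M.triangleAt a b = M.Ψ '' convexHull ℝ {0, toPlane a, toPlane b} := by
  have := M.face 0 a b h
  rw [toPlane_zero] at this
  rw [triangleAt, this]

namespace IsLongitude

variable {M : Marking α p q r m} {θ : ℝ × ℝ → ℝ}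

lemma one_coord_pos (hθ : M.IsLongitude θ) {e : ℤ × ℤ} (h0 : 0 < θ (toPlane e))
    (h1 : θ (toPlane e) < Real.pi) : 0 < M.Ψ (toPlane e) 1 := by
  obtain ⟨ρ, hρ, h⟩ := hθ.ray (toPlane e)
  have := congrArg Complex.im h
  rw [Complex.im_ofReal_mul, Complex.exp_ofReal_mul_I_im] at this
  change M.Ψ (toPlane e) 1 = _ at this
  rw [this]
  exact mul_pos hρ (Real.sin_pos_of_pos_of_lt_pi h0 h1)

lemma one_coord_neg (hθ : M.IsLongitude θ) {e : ℤ × ℤ} (h0 : 0 < θ (toPlane e))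
    (h1 : θ (toPlane e) < Real.pi) : M.Ψ (toPlane (-e)) 1 < 0 := by
  obtain ⟨ρ, hρ, h⟩ := hθ.ray (toPlane (-e))
  have := congrArg Complex.im h
  rw [Complex.im_ofReal_mul, Complex.exp_ofReal_mul_I_im, hθ.neg, Real.sin_neg] at this
  change M.Ψ (toPlane (-e)) 1 = _ at this
  rw [this]
  have := mul_pos hρ (Real.sin_pos_of_pos_of_lt_pi h0 h1)
  linarith

variable {P Q E : ℤ × ℤ}

/-- The orientation convention: `deck` increases to the left of the meridian. -/
lemma deck_neg_pos (hθ : M.IsLongitude θ) (h : FareyBasis p q r m P Q E) (hα : 1 < ‖(α : ℂ)‖)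
    (hP : 0 < θ (toPlane P)) (hQ : 0 < θ (toPlane Q)) : M.deck P < 0 ∧ 0 < M.deck Q := by
  rcases M.deck_neg_pos_or h with h1 | ⟨h1, h2⟩
  · exact h1
  · exfalso
    have hP' := (abs_lt.1 (hθ.abs_lt_pi h hα ((h.isEdgeVec_iff P).2 (by tauto)))).2
    have hQ' := (abs_lt.1 (hθ.abs_lt_pi h hα ((h.isEdgeVec_iff Q).2 (by tauto)))).2
    have hD := M.det3_pos h
    have y1 := hθ.one_coord_pos hP hP'
    have y2 := hθ.one_coord_pos hQ hQ'
    rw [M.Ψ_toPlane] at y1 y2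
    have z1 := orbitPt_two_pos hα h1
    have z2 := orbitPt_two_neg hα h2
    rw [orbitPt_zero, det3_eq] at hD
    simp [basePt] at hD
    nlinarith [mul_pos z1 y2, mul_pos y1 (neg_pos.2 z2)]

/-- A point of height `0` on the edge of slope `r` opposite to `v` has longitude in `(0, π)`, so the
face with vertices `v, P, Q` contains the points of `J` of small positive longitude. -/
lemma isFirstTriangle (hθ : M.IsLongitude θ) (h : FareyBasis p q r m P Q E)
    (hα : 1 < ‖(α : ℂ)‖) (hP : 0 < θ (toPlane P)) (hQ : 0 < θ (toPlane Q)) :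
    M.IsFirstTriangle P Q := by
  have hP' := (abs_lt.1 (hθ.abs_lt_pi h hα ((h.isEdgeVec_iff P).2 (by tauto)))).2
  have hQ' := (abs_lt.1 (hθ.abs_lt_pi h hα ((h.isEdgeVec_iff Q).2 (by tauto)))).2
  obtain ⟨hdP, hdQ⟩ := hθ.deck_neg_pos h hα hP hQ
  have y1 := hθ.one_coord_pos hP hP'
  have y2 := hθ.one_coord_pos hQ hQ'
  have z1 : M.Ψ (toPlane P) 2 < 0 := by rw [M.Ψ_toPlane]; exact orbitPt_two_neg hα hdP
  have z2 : 0 < M.Ψ (toPlane Q) 2 := by rw [M.Ψ_toPlane]; exact orbitPt_two_pos hα hdQ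
  refine ⟨h.isPlaneTriangle_PQ, ?_⟩
  set a := M.Ψ (toPlane P) with ha
  set b := M.Ψ (toPlane Q) with hb
  -- A point of height `0` on the opposite edge, up to scale, is `u = b 2 • a - a 2 • b`.
  set X := b 2 * a 0 - a 2 * b 0 with hX
  set Y := b 2 * a 1 - a 2 * b 1 with hY
  have hYpos : 0 < Y := by
    have := mul_pos z2 y1
    have := mul_pos (neg_pos.2 z1) y2
    linarith
  have hcont : Continuous fun t : ℝ => Real.cos t - Real.sin t * (X / Y) := by fun_prop
  have hev : ∀ᶠ t in 𝓝 (0 : ℝ), 0 < Real.cos t - Real.sin t * (X / Y) :=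
    hcont.continuousAt.eventually (lt_mem_nhds (by simp))
  obtain ⟨ε, hε, hball⟩ := Metric.eventually_nhds_iff.1 hev
  refine ⟨min ε Real.pi, lt_min hε Real.pi_pos, fun t ht => ?_⟩
  have ht1 : t < ε := ht.2.trans_le (min_le_left _ _)
  have ht2 : t < Real.pi := ht.2.trans_le (min_le_right _ _)
  have hγ := hball (y := t) (by rw [Real.dist_eq, sub_zero, abs_of_pos ht.1]; exact ht1)
  have hs := Real.sin_pos_of_pos_of_lt_pi ht.1 ht2
  set γ := Real.cos t - Real.sin t * (X / Y) with hγdef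
  have hβ : 0 < Real.sin t / Y := div_pos hs hYpos
  set β := Real.sin t / Y with hβdef
  have hbpos := mul_pos hβ z2
  have hapos := mul_pos hβ (neg_pos.2 z1)
  have htot : 0 < γ + β * b 2 + β * -a 2 := by linarith
  refine ⟨(γ + β * b 2 + β * -a 2)⁻¹, inv_pos.2 htot, ?_⟩
  rw [triangleAt, mem_convexHull_triple]
  refine ⟨(γ + β * b 2 + β * -a 2)⁻¹ * γ, (γ + β * b 2 + β * -a 2)⁻¹ * (β * b 2),
    (γ + β * b 2 + β * -a 2)⁻¹ * (β * -a 2), by positivity, by positivity, by positivity, ?_, ?_⟩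
  · rw [← mul_add, ← mul_add, inv_mul_cancel₀ htot.ne']
  · have e0 : γ + β * b 2 * a 0 + β * -a 2 * b 0 = Real.cos t := by
      rw [hγdef, hβdef, hX]; field_simp; ring
    have e1 : β * b 2 * a 1 + β * -a 2 * b 1 = Real.sin t := by
      have : β * Y = Real.sin t := by rw [hβdef]; field_simp
      rw [← this, hY]; ring
    rw [M.map_zero, ← ha, ← hb, ← e0, ← e1]
    set k := (γ + β * b 2 + β * -a 2)⁻¹
    ext i
    fin_cases i <;> simp [basePt] <;> ring

/-- Only two faces at `v` have other vertices of both signs of height, and of these the one with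
vertices `-P, -Q` lies on the side of negative longitudes. -/
lemma eq_of_isFirstTriangle (hθ : M.IsLongitude θ) (h : FareyBasis p q r m P Q E)
    (hα : 1 < ‖(α : ℂ)‖) (hP : 0 < θ (toPlane P)) (hQ : 0 < θ (toPlane Q)) {a b : ℤ × ℤ}
    (hab : M.IsFirstTriangle a b) : M.triangleAt a b = M.triangleAt P Q := by
  obtain ⟨htri, ε, hε, hseg⟩ := hab
  have hP' := (abs_lt.1 (hθ.abs_lt_pi h hα ((h.isEdgeVec_iff P).2 (by tauto)))).2
  have hQ' := (abs_lt.1 (hθ.abs_lt_pi h hα ((h.isEdgeVec_iff Q).2 (by tauto)))).2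
  obtain ⟨hdP, hdQ⟩ := hθ.deck_neg_pos h hα hP hQ
  have yP := hθ.one_coord_neg hP hP'
  have yQ := hθ.one_coord_neg hQ hQ'
  -- The triangle contains a point of height `0` and of small positive longitude.
  have ht0 : 0 < min ε Real.pi / 2 := by have := lt_min hε Real.pi_pos; positivity
  have htε : min ε Real.pi / 2 < ε := by have := min_le_left ε Real.pi; linarith
  have htπ : min ε Real.pi / 2 < Real.pi := by
    have := min_le_right ε Real.pi; linarith [Real.pi_pos]
  obtain ⟨ρ, hρ, hmem⟩ := hseg _ ⟨ht0, htε⟩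
  have hy := mul_pos hρ (Real.sin_pos_of_pos_of_lt_pi ht0 htπ)
  rw [triangleAt, mem_convexHull_triple] at hmem
  obtain ⟨s, t, u, hs, ht, hu, -, hsum⟩ := hmem
  have e1 : t * M.Ψ (toPlane a) 1 + u * M.Ψ (toPlane b) 1 =
      ρ * Real.sin (min ε Real.pi / 2) := by
    have := congrArg (fun y : E3 => y 1) hsum
    simpa [M.map_zero, basePt] using this
  have e2 : t * M.Ψ (toPlane a) 2 + u * M.Ψ (toPlane b) 2 = 0 := by
    have := congrArg (fun y : E3 => y 2) hsum
    simpa [M.map_zero, basePt] using this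
  have hnot : ¬ (t = 0 ∧ u = 0) := by
    rintro ⟨rfl, rfl⟩
    linarith
  have hpp : ¬ (0 < M.deck a ∧ 0 < M.deck b) := by
    rintro ⟨h1, h2⟩
    have h3 := (M.two_coord_pos_iff hα a).2 h1
    have h4 := (M.two_coord_pos_iff hα b).2 h2
    refine hnot ⟨?_, ?_⟩ <;> nlinarith [mul_nonneg ht h3.le, mul_nonneg hu h4.le]
  have hnn : ¬ (M.deck a < 0 ∧ M.deck b < 0) := by
    rintro ⟨h1, h2⟩
    have h3 : M.Ψ (toPlane a) 2 < 0 := by rw [M.Ψ_toPlane]; exact orbitPt_two_neg hα h1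
    have h4 : M.Ψ (toPlane b) 2 < 0 := by rw [M.Ψ_toPlane]; exact orbitPt_two_neg hα h2
    refine hnot ⟨?_, ?_⟩ <;>
      nlinarith [mul_nonneg ht (neg_nonneg.2 h3.le), mul_nonneg hu (neg_nonneg.2 h4.le)]
  have hnPQ : ¬ (a = -P ∧ b = -Q) := by
    rintro ⟨rfl, rfl⟩
    nlinarith [mul_nonneg ht (neg_nonneg.2 yP.le), mul_nonneg hu (neg_nonneg.2 yQ.le)]
  have hnQP : ¬ (a = -Q ∧ b = -P) := by
    rintro ⟨rfl, rfl⟩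
    nlinarith [mul_nonneg ht (neg_nonneg.2 yQ.le), mul_nonneg hu (neg_nonneg.2 yP.le)]
  obtain ⟨hA, hBA, hB⟩ := htri
  rw [sub_zero, h.isEdgeVec_iff] at hA
  rw [zero_sub, h.isEdgeVec_iff] at hB
  rw [h.isEdgeVec_iff] at hBA
  have hcases : (a = P ∧ b = Q) ∨ (a = Q ∧ b = P) := by
    have hdet := h.det_eq
    have hB' : b = -P ∨ b = P ∨ b = -Q ∨ b = Q ∨ b = Q - P ∨ b = P - Q := by
      rcases hB with h | h | h | h | h | h <;> rw [neg_eq_iff_eq_neg] at h <;> rw [h] <;> simp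
    -- Compare coordinates with respect to the basis `P, Q`.
    have hco : ∀ e, (e = P ∨ e = -P ∨ e = Q ∨ e = -Q ∨ e = P - Q ∨ e = Q - P) →
        (det2 e Q = 1 ∧ det2 P e = 0) ∨ (det2 e Q = -1 ∧ det2 P e = 0) ∨
        (det2 e Q = 0 ∧ det2 P e = 1) ∨ (det2 e Q = 0 ∧ det2 P e = -1) ∨
        (det2 e Q = 1 ∧ det2 P e = -1) ∨ (det2 e Q = -1 ∧ det2 P e = 1) := by
      rintro e (rfl | rfl | rfl | rfl | rfl | rfl) <;>
        simp [det2_neg_left, det2_neg_right, det2_sub_left, det2_sub_right, det2_self, hdet]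
    have hBA' := hco _ hBA
    clear hco hBA hB hsum e1 e2 hnot
    rcases hA with rfl | rfl | rfl | rfl | rfl | rfl <;>
      rcases hB' with rfl | rfl | rfl | rfl | rfl | rfl <;>
      first
      | exact Or.inl ⟨rfl, rfl⟩
      | exact Or.inr ⟨rfl, rfl⟩
      | exact absurd ⟨rfl, rfl⟩ hnPQ
      | exact absurd ⟨rfl, rfl⟩ hnQP
      | (exfalso
         try simp only [map_neg, map_sub] at hpp hnn
         simp only [det2_neg_left, det2_neg_right, det2_sub_left, det2_sub_right, det2_self,
           hdet] at hBA'
         omega)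
  rcases hcases with ⟨rfl, rfl⟩ | ⟨rfl, rfl⟩
  · rfl
  · rw [triangleAt, triangleAt, Set.pair_comm]

/-- The vectors `w` of the cone of `P, Q` give the oriented lifts. -/
lemma isOrientedLift_iff (hθ : M.IsLongitude θ) (h : FareyBasis p q r m P Q E)
    (hα : 1 < ‖(α : ℂ)‖) (hP : 0 < θ (toPlane P)) (hQ : 0 < θ (toPlane Q)) {x : Slope}
    {w : ℤ × ℤ} (hw : IsRep w x)
    (hcone : ∃ w₁ w₂ : ℤ, 0 ≤ w₁ ∧ 0 ≤ w₂ ∧ 0 < w₁ + w₂ ∧ w = w₁ • P + w₂ • Q) (w' : ℤ × ℤ) :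
    M.IsOrientedLift x w' ↔ w' = w := by
  obtain ⟨w₁, w₂, h1, h2, h3, hwe⟩ := hcone
  have h1' : (0 : ℝ) ≤ w₁ := by exact_mod_cast h1
  have h2' : (0 : ℝ) ≤ w₂ := by exact_mod_cast h2
  have h3' : (0 : ℝ) < w₁ + w₂ := by exact_mod_cast h3
  constructor
  · rintro ⟨hrep, a, b, hab, ε, hε, hseg⟩
    rcases hw.eq_or_eq_neg hrep with rfl | rfl
    · rfl
    · exfalso
      rw [hθ.eq_of_isFirstTriangle h hα hP hQ hab, M.triangleAt_eq h.isPlaneTriangle_PQ] at hseg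
      -- A small multiple of `-w` would differ from a point of the triangle by a multiple of `E`.
      have hinv : 0 < ((w₁ : ℝ) + w₂)⁻¹ := inv_pos.2 h3'
      obtain ⟨t, ht0, ht1⟩ := exists_between (lt_min hε hinv)
      obtain ⟨y, hy, hyt⟩ := hseg t ⟨ht0, ht1.trans_le (min_le_left _ _)⟩
      obtain ⟨e, he, hye⟩ := (M.map_eq_iff (t • toPlane (-w)) y 0).1 (by
        rw [← hyt, ← M.deck.map_zero, ← M.Ψ_add, toPlane_zero, add_zero])
      obtain ⟨j, rfl⟩ := M.exists_smul_of_deck_eq_zero h he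
      obtain ⟨k, l, hk, hl, hE⟩ := h.cone
      rw [mem_convexHull_triple] at hy
      obtain ⟨s, β, γ, hs, hβ, hγ, hsum, hy⟩ := hy
      have hL := congrArg (edgeForm P Q) hye
      rw [← hy, smul_zero, zero_add, edgeForm_add, edgeForm_add, edgeForm_smul, edgeForm_smul,
        edgeForm_smul, toPlane_smul, edgeForm_smul, toPlane_neg, hE, hwe,
        edgeForm_toPlane_left h.det_eq, edgeForm_toPlane_right h.det_eq,
        edgeForm_smul_add h.det_eq, ← neg_one_smul ℝ, edgeForm_smul,
        edgeForm_smul_add h.det_eq] at hL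
      have ht2 : t * (w₁ + w₂) < 1 := by
        have := mul_lt_mul_of_pos_right (ht1.trans_le (min_le_right _ _)) h3'
        rwa [inv_mul_cancel₀ h3'.ne'] at this
      have ht3 : 0 < t * (w₁ + w₂) := mul_pos ht0 h3'
      have hj1 : (0 : ℝ) < j * (k + l) := by linarith
      have hj2 : (j : ℝ) * (k + l) < 2 := by linarith
      have hj1' : 0 < j * (k + l) := by exact_mod_cast hj1
      have hj2' : j * (k + l) < 2 := by exact_mod_cast hj2
      have hj : 0 < j := by
        by_contra hneg
        push Not at hneg
        nlinarith
      nlinarith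
  · rintro rfl
    refine ⟨hw, P, Q, hθ.isFirstTriangle h hα hP hQ, ((w₁ : ℝ) + w₂)⁻¹, inv_pos.2 h3', ?_⟩
    intro t ht
    rw [M.triangleAt_eq h.isPlaneTriangle_PQ]
    refine ⟨_, ?_, rfl⟩
    have ht2 : t * (w₁ + w₂) < 1 := by
      have := mul_lt_mul_of_pos_right ht.2 h3'
      rwa [inv_mul_cancel₀ h3'.ne'] at this
    have ht0 := ht.1.le
    rw [mem_convexHull_triple]
    refine ⟨1 - t * (w₁ + w₂), t * w₁, t * w₂, by linarith, by positivity, by positivity, by ring,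
      ?_⟩
    rw [hwe, toPlane_add, toPlane_smul, toPlane_smul, smul_zero, zero_add, _root_.smul_add,
      smul_smul, smul_smul]

end IsLongitude

end Marking

/-! ### Invariants and handedness -/

/-- The handedness of a power `φ ^ n` such that `α ^ n` is in the upper half-plane: for `n < 0` the
normal form of `φ ^ n` is `z ↦ α ^ (-n) z`. -/
lemma isLeftHanded_or_of_im_pos {α : ℂˣ} (hα : 1 < ‖(α : ℂ)‖) {n : ℤ}
    (h : 0 < ((α : ℂ) ^ n).im) :
    (0 < n → IsLeftHanded (phi α ^ n)) ∧ (n < 0 → IsRightHanded (phi α ^ n)) := by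
  have hα0 : (α : ℂ) ≠ 0 := α.ne_zero
  constructor
  · intro hn
    refine ⟨(α : ℂ) ^ n, ?_, h, 1, 1, ?_⟩
    · rw [norm_zpow]; exact one_lt_zpow₀ hα hn
    · rw [one_mul, inv_one, mul_one, phi_zpow, coe_phi, one_smul, Units.val_zpow_eq_zpow_val]
  · intro hn
    -- The inversion `z ↦ 1 / z` conjugates `z ↦ β z` to `z ↦ β⁻¹ z`.
    let J : GL (Fin 2) ℂ := Matrix.GeneralLinearGroup.mkOfDetNeZero !![0, 1; 1, 0] (by simp)
    have hJ : (J : Matrix (Fin 2) (Fin 2) ℂ) = !![0, 1; 1, 0] := rfl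
    have hJJ : J⁻¹ = J := by
      rw [inv_eq_iff_mul_eq_one]
      ext i j
      rw [Matrix.GeneralLinearGroup.coe_mul, hJ]
      fin_cases i <;> fin_cases j <;> simp
    refine ⟨((α : ℂ) ^ n)⁻¹, ?_, ?_, J, (α : ℂ) ^ n, ?_⟩
    · rw [norm_inv, norm_zpow]
      exact one_lt_inv_iff₀.2 ⟨zpow_pos (by linarith) _, zpow_lt_one_of_neg₀ hα hn⟩
    · rw [Complex.inv_im]
      exact div_neg_of_neg_of_pos (neg_neg_of_pos h)
        (Complex.normSq_pos.2 (zpow_ne_zero _ hα0))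
    · rw [hJJ, Matrix.GeneralLinearGroup.coe_mul, Matrix.GeneralLinearGroup.coe_mul, hJ, phi_zpow,
        coe_phi, Units.val_zpow_eq_zpow_val]
      have := zpow_ne_zero n hα0
      ext i j
      fin_cases i <;> fin_cases j <;> simp [this]

namespace Marking

variable {α : ℂˣ} {p q r m : Slope}

/-- The invariants of a pivot, with the sign of the basis chosen such that the longitude increases
along the edges from `v` to the vertices of `P` and `Q`. -/
lemma IsLongitude.hasInvariants_iff {M : Marking α p q r m} {θ : ℝ × ℝ → ℝ}
    (hθ : M.IsLongitude θ) {P Q E : ℤ × ℤ} (h : FareyBasis p q r m P Q E)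
    (hα : 1 < ‖(α : ℂ)‖) (hP : 0 < θ (toPlane P)) (hQ : 0 < θ (toPlane Q)) {x : Slope}
    {w : ℤ × ℤ} (hw : IsRep w x) (hpiv : IsPivotVec P Q E w) (ν : ℤ) (l : ℝ) :
    M.HasInvariants x ν l ↔ ν = M.deck w ∧ l = θ (toPlane w) := by
  constructor
  · rintro ⟨w', hlift, hν, hl⟩
    rw [hθ.isOrientedLift_iff h hα hP hQ hw hpiv.1] at hlift
    subst hlift
    refine ⟨?_, (hθ.hasLongitudeIntegral_iff w' l).1 hl⟩
    obtain ⟨e, he, hwe⟩ := (M.map_eq_iff 0 (toPlane w') ν).1 (by rw [M.map_zero, hν])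
    rw [zero_add] at hwe
    rw [toPlane_injective hwe, he]
  · rintro ⟨rfl, rfl⟩
    exact ⟨w, (hθ.isOrientedLift_iff h hα hP hQ hw hpiv.1 w).2 rfl, M.Ψ_toPlane w,
      (hθ.hasLongitudeIntegral_iff w _).2 rfl⟩

/-- The longitude integral of a pivot is less than half of that of the meridian. -/
lemma IsLongitude.pivot_mem_Ioo {M : Marking α p q r m} {θ : ℝ × ℝ → ℝ}
    (hθ : M.IsLongitude θ) {P Q E : ℤ × ℤ} (h : FareyBasis p q r m P Q E)
    (hα : 1 < ‖(α : ℂ)‖) (hP : 0 < θ (toPlane P)) (hQ : 0 < θ (toPlane Q)) {w : ℤ × ℤ}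
    (hpiv : IsPivotVec P Q E w) : θ (toPlane w) ∈ Ioo 0 Real.pi := by
  have hcone : ∀ x y : ℤ, 0 ≤ x → 0 ≤ y → 0 < x + y → 0 < θ (toPlane (x • P + y • Q)) := by
    intro x y hx hy hxy
    rw [hθ.smul_add]
    have hx' : (0 : ℝ) ≤ x := by exact_mod_cast hx
    have hy' : (0 : ℝ) ≤ y := by exact_mod_cast hy
    have hxy' : (0 : ℝ) < x + y := by exact_mod_cast hxy
    rcases hx'.lt_or_eq with h | h
    · have := mul_pos h hP
      have := mul_nonneg hy' hQ.le
      linarith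
    · rw [← h, zero_add] at hxy'
      rw [← h, zero_mul, zero_add]
      exact mul_pos hxy' hQ
  obtain ⟨⟨w₁, w₂, h1, h2, h3, hwe⟩, y₁, y₂, A, B, h4, h5, h6, hA, hB, hE⟩ := hpiv
  have hw0 : 0 < θ (toPlane w) := by rw [hwe]; exact hcone _ _ h1 h2 h3
  have hy0 := hcone _ _ h4 h5 h6
  set y := y₁ • P + y₂ • Q
  have hEpos : 0 < θ (toPlane E) := by
    obtain ⟨k, l, hk, hl, e⟩ := h.cone
    rw [e]; exact hcone _ _ hk.le hl.le (by omega)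
  have h2π := hθ.meridian_eq h hα hEpos
  rw [hE, hθ.smul_add, toPlane_add, hθ.add] at h2π
  have hA' : (1 : ℝ) ≤ A := by exact_mod_cast hA
  have hB' : (1 : ℝ) ≤ B := by exact_mod_cast hB
  refine ⟨hw0, ?_⟩
  nlinarith [mul_nonneg (sub_nonneg.2 hA') hw0.le,
    mul_nonneg (sub_nonneg.2 hB') (add_pos hw0 hy0).le]

/-- The sign of `deck` is the side of the meridian. -/
lemma IsLongitude.deck_pos_iff {M : Marking α p q r m} {θ : ℝ × ℝ → ℝ}
    (hθ : M.IsLongitude θ) {P Q E : ℤ × ℤ} (h : FareyBasis p q r m P Q E)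
    (hα : 1 < ‖(α : ℂ)‖) (hP : 0 < θ (toPlane P)) (hQ : 0 < θ (toPlane Q)) (w : ℤ × ℤ) :
    (0 < det2 E w → 0 < M.deck w) ∧ (det2 E w < 0 → M.deck w < 0) := by
  obtain ⟨-, hdQ⟩ := hθ.deck_neg_pos h hα hP hQ
  obtain ⟨k, l, hk, hl, hE⟩ := h.cone
  have h0 := M.deck_meridian h
  have key : k * M.deck w = det2 E w * M.deck Q := by
    have hw := eq_smul_add_smul (Or.inl h.det_eq) w
    rw [h.det_eq, one_mul, one_mul] at hw
    have hd : M.deck w = det2 w Q * M.deck P + det2 P w * M.deck Q := by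
      conv_lhs => rw [hw]
      exact M.deck_smul_add _ _
    rw [hE, M.deck_smul_add] at h0
    rw [hd, hE, det2_add_left, det2_smul_left, det2_smul_left, det2_comm Q w]
    linear_combination (det2 w Q) * h0
  constructor
  · intro hpos
    have := mul_pos hpos hdQ
    rw [← key] at this
    exact (mul_pos_iff_of_pos_left hk).1 this
  · intro hneg
    have := mul_neg_of_neg_of_pos hneg hdQ
    rw [← key] at this
    by_contra hcon
    exact absurd this (not_lt.2 (mul_nonneg hk.le (not_lt.1 hcon)))

end Marking

end FareyTorus

theorem proposition4p5 (α : ℂˣ) (hα : 1 < ‖(α : ℂ)‖) (p q r m : FareyTorus.Slope)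
    (N : ℕ) (T : ℕ → Finset FareyTorus.Slope) (hT : FareyTorus.IsFareyPath p q r m N T)
    (M : FareyTorus.Marking α p q r m)
    (i : ℕ) (hi : 1 ≤ i) (hiN : i ≤ N - 1)
    (x : FareyTorus.Slope) (hx₀ : x ∈ T (i - 1)) (hx₁ : x ∈ T i) (hx₂ : x ∈ T (i + 1)) :
    (∃ (ν : ℤ) (l : ℝ), M.HasInvariants x ν l) ∧
    ∀ (ν : ℤ) (l : ℝ), M.HasInvariants x ν l →
      l ∈ Set.Ioo 0 Real.pi ∧
      (FareyTorus.CarriesL r m T i → 0 < ν) ∧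
      (FareyTorus.CarriesR r m T i → ν < 0) ∧
      (FareyTorus.CarriesL r m T i → FareyTorus.IsLeftHanded (FareyTorus.phi α ^ ν)) ∧
      (FareyTorus.CarriesR r m T i → FareyTorus.IsRightHanded (FareyTorus.phi α ^ ν)) := by
  obtain ⟨P, Q, E, h, hpivot⟩ := hT.exists_pivot
  obtain ⟨w, hw, hpiv, hL, hR⟩ := hpivot i x hi hiN hx₀ hx₁ hx₂
  obtain ⟨θ, hθ⟩ := M.exists_isLongitude h hα
  -- Change all signs, if necessary, so that the longitude increases towards `P` and `Q`.
  obtain ⟨P, Q, E, w, h, hw, hpiv, hL, hR, hP, hQ⟩ : ∃ P Q E w,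
      FareyTorus.FareyBasis p q r m P Q E ∧ FareyTorus.IsRep w x ∧
      FareyTorus.IsPivotVec P Q E w ∧ (FareyTorus.CarriesL r m T i → 0 < FareyTorus.det2 E w) ∧
      (FareyTorus.CarriesR r m T i → FareyTorus.det2 E w < 0) ∧
      0 < θ (FareyTorus.toPlane P) ∧ 0 < θ (FareyTorus.toPlane Q) := by
    rcases hθ.same_sign h hα with ⟨hP, hQ⟩ | ⟨hP, hQ⟩
    · exact ⟨P, Q, E, w, h, hw, hpiv, hL, hR, hP, hQ⟩
    · refine ⟨-P, -Q, -E, -w, h.neg, hw.neg, hpiv.neg, ?_, ?_, ?_, ?_⟩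
      · rwa [FareyTorus.det2_neg_left, FareyTorus.det2_neg_right, neg_neg]
      · rwa [FareyTorus.det2_neg_left, FareyTorus.det2_neg_right, neg_neg]
      · rw [hθ.neg]; linarith
      · rw [hθ.neg]; linarith
  have hinv := hθ.hasInvariants_iff h hα hP hQ hw hpiv
  refine ⟨⟨_, _, (hinv _ _).2 ⟨rfl, rfl⟩⟩, fun ν l hνl => ?_⟩
  obtain ⟨rfl, rfl⟩ := (hinv ν l).1 hνl
  have hθw := hθ.pivot_mem_Ioo h hα hP hQ hpiv
  obtain ⟨hpos, hneg⟩ := hθ.deck_pos_iff h hα hP hQ w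
  have him : 0 < ((α : ℂ) ^ M.deck w).im := by
    obtain ⟨ρ, hρ, e⟩ := hθ.im_zpow_deck w
    rw [e]
    exact mul_pos hρ (Real.sin_pos_of_pos_of_lt_pi hθw.1 hθw.2)
  obtain ⟨hleft, hright⟩ := FareyTorus.isLeftHanded_or_of_im_pos hα him
  exact ⟨hθw, fun c => hpos (hL c), fun c => hneg (hR c), fun c => hleft (hpos (hL c)),
    fun c => hright (hneg (hR c))⟩
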